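/- Let $m>0$ and let $V=(V_{ij})\in L^1(\mathbb R_+,\mathrm{Mat}(2,\mathbb C))$ be a (not necessarily Hermitian) matrix-valued potential. For $c>0$ and $\alpha\in[0,\pi/2]$ let $D_0+V$ be the Dirac operator $$D_0+V=\begin{pmatrix} mc^2 & -c\frac{d}{dx}\\ c\frac{d}{dx} & -mc^2\end{pmatrix}+V(x)\quad\text{in } L^2(\mathbb R_+,\mathbb C^2)$$ with boundary condition $\psi_1(0)\cos\alpha-\psi_2(0)\sin\alpha=0$; its domain consists of all $\psi\in L^2(\mathbb R_+,\mathbb C^2)$ that are locally absolutely continuous on $[0,\infty)$, satisfy the boundary condition, and for which $(D_0+V)\psi\in L^2(\mathbb R_+,\mathbb C^2)$. Similarly, for $s=\pm\frac1{2m}$ and $q\in L^1(\mathbb R_+)$, the operator $s\frac{d^2}{dx^2}+q$ in $L^2(\mathbb R_+)$ with Dirichlet ($u(0)=0$) or Neumann ($u'(0)=0$) boundary condition is defined on all $u\in L^2(\mathbb R_+)$ such that $u,u'$ are locally absolutely continuous on $[0,\infty)$, the boundary condition holds, and $su''+qu\in L^2(\mathbb R_+)$. Then, as $c\to\infty$,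 the following limits exist in the norm-resolvent sense: $$(D_0+V+mc^2)^{-1}\to 0\oplus\Big(\tfrac1{2m}\tfrac{d^2}{dx^2}+V_{22}\Big)^{-1},\qquad (D_0+V-mc^2)^{-1}\to\Big(-\tfrac1{2m}\tfrac{d^2}{dx^2}+V_{11}\Big)^{-1}\oplus 0 .$$ In particular, if $V$ is a scalar multiple of the identity matrix, both $V_{11}$ and $V_{22}$ are this scalar potential. In the first limit, the operator $\frac1{2m}\frac{d^2}{dx^2}+V_{22}$ carries (a) the Dirichlet condition if $\alpha\in(0,\pi/2]$, (b) the Neumann condition if $\alpha=0$. In the second limit, the operator $-\frac1{2m}\frac{d^2}{dx^2}+V_{11}$ carries (c) the Dirichlet condition if $\alpha\in[0,\pi/2)$, (d) the Neumann condition if $\alpha=\pi/2$. Here convergence in the norm-resolvent sense to $0\oplus S^{-1}$ (resp. $S^{-1}\oplus 0$) means: the resolvent set $\rho(S)$ is non-empty, and for every $z\in\rho(S)$ one has $z\in\rho(D_0+V\pm mc^2)$ for all sufficiently large $c$, and $(D_0+V\pm mc^2-z)^{-1}\to 0\oplus(S-z)^{-1}$ (resp. $(S-z)^{-1}\oplus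 0$) in operator norm on $L^2(\mathbb R_+,\mathbb C^2)=L^2(\mathbb R_+)\oplus L^2(\mathbb R_+)$. -/

import Mathlib

open MeasureTheory Set Filter Topology

noncomputable section

namespace HalfLineDirac

/-! ### Hilbert spaces on the half-line -/

/-- Lebesgue measure on the half-line `(0, ∞)`. -/
abbrev halfLine : Measure ℝ := volume.restrict (Ioi 0)

/-- The Hilbert space `L²(ℝ₊)` of complex-valued functions. -/
abbrev L2 : Type := Lp ℂ 2 halfLine

/-- The Hilbert space `L²(ℝ₊, ℂ²)`, written through its two components as the Hilbert space direct
sum `L²(ℝ₊) ⊕ L²(ℝ₊)`, with norm `‖ψ‖² = ‖ψ₁‖² + ‖ψ₂‖²`. -/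
abbrev Spinor : Type := WithLp 2 (L2 × L2)

/-- The direct sum `A ⊕ B` of two bounded operators on `L²(ℝ₊)`, acting on `L²(ℝ₊, ℂ²)`. -/
def directSum (A B : L2 →L[ℂ] L2) : Spinor →L[ℂ] Spinor :=
  ((WithLp.prodContinuousLinearEquiv 2 ℂ L2 L2).symm : (L2 × L2) →L[ℂ] Spinor) ∘L
    (A.prodMap B) ∘L (WithLp.prodContinuousLinearEquiv 2 ℂ L2 L2 : Spinor →L[ℂ] (L2 × L2))

/-! ### Unbounded operators, resolvents, norm-resolvent convergence -/

section Resolvent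

variable {E : Type*} [NormedAddCommGroup E] [NormedSpace ℂ E]

/-- `R = (T - z)⁻¹`: the bounded everywhere defined operator `R` is a two-sided inverse of the
unbounded operator `T - z`. -/
structure IsResolventAt (T : E →ₗ.[ℂ] E) (z : ℂ) (R : E →L[ℂ] E) : Prop where
  left_inv : ∀ x : T.domain, R (T x - z • (x : E)) = x
  right_inv : ∀ y : E, ∃ x : T.domain, (x : E) = R y ∧ T x - z • (x : E) = y

theorem IsResolventAt.unique {T : E →ₗ.[ℂ] E} {z : ℂ} {R R' : E →L[ℂ] E}
    (h : IsResolventAt T z R) (h' : IsResolventAt T z R') : R = R' := by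
  ext y
  obtain ⟨x, hx, hy⟩ := h.right_inv y
  rw [← hx, ← h'.left_inv x, hy]

/-- The resolvent set `ρ(T)` of an unbounded operator. -/
def resolventSet (T : E →ₗ.[ℂ] E) : Set ℂ := {z | ∃ R : E →L[ℂ] E, IsResolventAt T z R}

open Classical in
/-- The resolvent `(T - z)⁻¹` for `z ∈ ρ(T)` (and `0` for other `z`). -/
def resolvent (T : E →ₗ.[ℂ] E) (z : ℂ) : E →L[ℂ] E :=
  if h : ∃ R : E →L[ℂ] E, IsResolventAt T z R then h.choose else 0

theorem isResolventAt_resolvent {T : E →ₗ.[ℂ] E} {z : ℂ} (hz : z ∈ resolventSet T) :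
    IsResolventAt T z (resolvent T z) := by
  have h : ∃ R : E →L[ℂ] E, IsResolventAt T z R := hz
  rw [resolvent, dif_pos h]
  exact h.choose_spec

/-- Adding a constant to an unbounded operator: `T + w`, with the same domain as `T`. -/
def addConst (T : E →ₗ.[ℂ] E) (w : ℂ) : E →ₗ.[ℂ] E :=
  (w • (LinearMap.id : E →ₗ[ℂ] E)) +ᵥ T

end Resolvent

/-- Norm-resolvent convergence, as `c → ∞`, of operators `T c` on a Banach space `E` to an operator
`S` that lives only on a part of `E`. The map `J` extends the resolvents of `S` to operators
on `E` (by zero on the complementary part). The resolvent set of `S` is not empty, and each of its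
points `z` belongs to the resolvent set of `T c` for all large `c`, with
`(T c - z)⁻¹ → J (S - z)⁻¹` in operator norm. -/
def NormResolventTendsto {E F : Type*} [NormedAddCommGroup E] [NormedSpace ℂ E]
    [NormedAddCommGroup F] [NormedSpace ℂ F] (T : ℝ → E →ₗ.[ℂ] E) (S : F →ₗ.[ℂ] F)
    (J : (F →L[ℂ] F) → (E →L[ℂ] E)) : Prop :=
  (resolventSet S).Nonempty ∧
    ∀ z ∈ resolventSet S, (∀ᶠ c in atTop, z ∈ resolventSet (T c)) ∧
      Tendsto (fun c => resolvent (T c) z) atTop (𝓝 (J (resolvent S z)))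

/-! ### Differential operators on the half-line -/

/-- `u` is locally absolutely continuous on `[0, ∞)` with derivative `g` almost everywhere, i.e. `u`
is an indefinite Lebesgue integral of the locally integrable function `g`. -/
structure IsACWithDeriv (u g : ℝ → ℂ) : Prop where
  intervalIntegrable : ∀ b : ℝ, 0 ≤ b → IntervalIntegrable g volume 0 b
  eq_integral : ∀ x : ℝ, 0 ≤ x → u x = u 0 + ∫ t in (0 : ℝ)..x, g t

namespace IsACWithDeriv

variable {u v g h : ℝ → ℂ}

theorem zero : IsACWithDeriv (fun _ => 0) (fun _ => 0) :=
  ⟨fun _ _ => intervalIntegrable_const, fun _ _ => by simp⟩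

theorem add (hu : IsACWithDeriv u g) (hv : IsACWithDeriv v h) :
    IsACWithDeriv (fun x => u x + v x) (fun x => g x + h x) := by
  refine ⟨fun b hb => (hu.1 b hb).add (hv.1 b hb), fun x hx => ?_⟩
  rw [intervalIntegral.integral_add (hu.1 x hx) (hv.1 x hx)]
  linear_combination hu.2 x hx + hv.2 x hx

theorem const_mul (a : ℂ) (hu : IsACWithDeriv u g) :
    IsACWithDeriv (fun x => a * u x) (fun x => a * g x) := by
  refine ⟨fun b hb => (hu.1 b hb).const_mul a, fun x hx => ?_⟩
  rw [intervalIntegral.integral_const_mul]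
  linear_combination a * hu.2 x hx

theorem continuousOn (hu : IsACWithDeriv u g) : ContinuousOn u (Ici 0) := by
  have key : ∀ b : ℝ, 0 ≤ b → ContinuousOn u (Icc 0 b) := by
    intro b hb
    have h1 : ContinuousOn (fun x => u 0 + ∫ t in (0 : ℝ)..x, g t) (Icc 0 b) := by
      refine continuousOn_const.add ?_
      have := intervalIntegral.continuousOn_primitive_interval
        (f := g) (μ := volume) (a := 0) (b := b)
        (by
          rw [uIcc_of_le hb, integrableOn_Icc_iff_integrableOn_Ioc]
          exact (intervalIntegrable_iff_integrableOn_Ioc_of_le hb).1 (hu.1 b hb))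
      rwa [uIcc_of_le hb] at this
    exact h1.congr fun x hx => hu.2 x hx.1
  intro x hx
  have h2 := key (x + 1) (by linarith [mem_Ici.1 hx]) x ⟨hx, by linarith⟩
  refine h2.mono_of_mem_nhdsWithin ?_
  have h3 : Ici (0 : ℝ) ∩ Iio (x + 1) ∈ 𝓝[Ici 0] x :=
    inter_mem self_mem_nhdsWithin (mem_nhdsWithin_of_mem_nhds (Iio_mem_nhds (by linarith)))
  exact mem_of_superset h3 fun y hy => ⟨hy.1, le_of_lt hy.2⟩

/-- A function that vanishes almost everywhere on the half-line vanishes on `[0, ∞)` if it is locally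
absolutely continuous, and so does its derivative almost everywhere. -/
theorem eq_zero (hu : IsACWithDeriv u g) (h0 : u =ᵐ[halfLine] fun _ => 0) :
    (∀ x, 0 ≤ x → u x = 0) ∧ g =ᵐ[halfLine] fun _ => 0 := by
  have h1 : ∀ x, 0 ≤ x → u x = 0 := by
    have h2 : EqOn u (fun _ => 0) (Ioi 0) :=
      Measure.eqOn_open_of_ae_eq h0 isOpen_Ioi (hu.continuousOn.mono Ioi_subset_Ici_self)
        continuousOn_const
    have h3 : EqOn u (fun _ => 0) (Ici 0) :=
      h2.of_subset_closure hu.continuousOn continuousOn_const Ioi_subset_Ici_self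
        (by rw [closure_Ioi])
    exact fun x hx => h3 hx
  refine ⟨h1, ?_⟩
  have h4 : ∀ x, 0 ≤ x → ∫ t in (0 : ℝ)..x, g t = 0 := by
    intro x hx
    have := hu.2 x hx
    rw [h1 x hx, h1 0 le_rfl, zero_add] at this
    exact this.symm
  have h5 : LocallyIntegrable ((Ioi (0 : ℝ)).indicator g) := by
    rw [locallyIntegrable_iff]
    intro K hK
    obtain ⟨b, hb⟩ := hK.bddAbove
    have hi : IntegrableOn g (Ioc 0 (max b 0)) :=
      (intervalIntegrable_iff_integrableOn_Ioc_of_le (le_max_right b 0)).1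
        (hu.1 _ (le_max_right b 0))
    rw [IntegrableOn, integrable_indicator_iff measurableSet_Ioi, IntegrableOn,
      Measure.restrict_restrict measurableSet_Ioi]
    exact hi.mono_set fun y hy => ⟨hy.1, (hb hy.2).trans (le_max_left b 0)⟩
  have h6 := LocallyIntegrable.ae_hasDerivAt_integral h5
  rw [Filter.EventuallyEq, ae_restrict_iff' measurableSet_Ioi]
  filter_upwards [h6] with x hx hx0
  have h7 := hx 0
  rw [indicator_of_mem hx0] at h7
  have h8 : (fun y => ∫ t in (0 : ℝ)..y, (Ioi (0 : ℝ)).indicator g t) =ᶠ[𝓝 x] fun _ => 0 := by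
    filter_upwards [Ioi_mem_nhds hx0] with y hy
    rw [← h4 y (le_of_lt hy), intervalIntegral.integral_of_le (le_of_lt hy),
      intervalIntegral.integral_of_le (le_of_lt hy)]
    exact setIntegral_congr_fun measurableSet_Ioc fun t ht => indicator_of_mem ht.1 g
  exact h7.unique ((hasDerivAt_const x (0 : ℂ)).congr_of_eventuallyEq h8)

end IsACWithDeriv

/-- The graph of the Dirac operator `D₀ + V` on `L²(ℝ₊, ℂ²)`, where
`D₀ = [[m c², -c d/dx], [c d/dx, -m c²]]`, with boundary condition
`ψ₁(0) cos α - ψ₂(0) sin α = 0`. A pair `(ψ, φ)` belongs to the graph iff `ψ` is (represented by) a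
locally absolutely continuous function satisfying the boundary condition and `φ = (D₀ + V) ψ`;
so the domain consists of all such `ψ ∈ L²` with `(D₀ + V) ψ ∈ L²`. -/
def diracGraph (m c α : ℝ) (V : ℝ → Matrix (Fin 2) (Fin 2) ℂ) : Submodule ℂ (Spinor × Spinor) where
  carrier := {p | ∃ u₁ u₂ g₁ g₂ : ℝ → ℂ, IsACWithDeriv u₁ g₁ ∧ IsACWithDeriv u₂ g₂ ∧
    p.1.fst =ᵐ[halfLine] u₁ ∧ p.1.snd =ᵐ[halfLine] u₂ ∧
    u₁ 0 * (Real.cos α : ℂ) - u₂ 0 * (Real.sin α : ℂ) = 0 ∧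
    (p.2.fst =ᵐ[halfLine] fun x =>
      (m * c ^ 2 : ℂ) * u₁ x - (c : ℂ) * g₂ x + (V x 0 0 * u₁ x + V x 0 1 * u₂ x)) ∧
    (p.2.snd =ᵐ[halfLine] fun x =>
      (c : ℂ) * g₁ x - (m * c ^ 2 : ℂ) * u₂ x + (V x 1 0 * u₁ x + V x 1 1 * u₂ x))}
  zero_mem' := by
    refine ⟨_, _, _, _, IsACWithDeriv.zero, IsACWithDeriv.zero, ?_, ?_, by simp, ?_, ?_⟩
    · exact Lp.coeFn_zero ℂ 2 halfLine
    · exact Lp.coeFn_zero ℂ 2 halfLine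
    · filter_upwards [Lp.coeFn_zero ℂ 2 halfLine] with x hx
      simpa using hx
    · filter_upwards [Lp.coeFn_zero ℂ 2 halfLine] with x hx
      simpa using hx
  add_mem' := by
    rintro p q ⟨u₁, u₂, g₁, g₂, hu₁, hu₂, h1, h2, h3, h4, h5⟩
      ⟨v₁, v₂, k₁, k₂, hv₁, hv₂, h1', h2', h3', h4', h5'⟩
    refine ⟨_, _, _, _, hu₁.add hv₁, hu₂.add hv₂, ?_, ?_, ?_, ?_, ?_⟩
    · filter_upwards [Lp.coeFn_add p.1.fst q.1.fst, h1, h1'] with x hx e e'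
      rw [← e, ← e']; exact hx
    · filter_upwards [Lp.coeFn_add p.1.snd q.1.snd, h2, h2'] with x hx e e'
      rw [← e, ← e']; exact hx
    · linear_combination h3 + h3'
    · filter_upwards [Lp.coeFn_add p.2.fst q.2.fst, h4, h4'] with x hx e e'
      refine hx.trans ?_
      rw [Pi.add_apply, e, e']; ring
    · filter_upwards [Lp.coeFn_add p.2.snd q.2.snd, h5, h5'] with x hx e e'
      refine hx.trans ?_
      rw [Pi.add_apply, e, e']; ring
  smul_mem' := by
    rintro a p ⟨u₁, u₂, g₁, g₂, hu₁, hu₂, h1, h2, h3, h4, h5⟩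
    refine ⟨_, _, _, _, hu₁.const_mul a, hu₂.const_mul a, ?_, ?_, ?_, ?_, ?_⟩
    · filter_upwards [Lp.coeFn_smul a p.1.fst, h1] with x hx e
      rw [← e]; exact hx
    · filter_upwards [Lp.coeFn_smul a p.1.snd, h2] with x hx e
      rw [← e]; exact hx
    · linear_combination a * h3
    · filter_upwards [Lp.coeFn_smul a p.2.fst, h4] with x hx e
      refine hx.trans ?_
      rw [Pi.smul_apply, e, smul_eq_mul]; ring
    · filter_upwards [Lp.coeFn_smul a p.2.snd, h5] with x hx e
      refine hx.trans ?_
      rw [Pi.smul_apply, e, smul_eq_mul]; ring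

/-- The Dirac operator `D₀ + V` on the half-line, with domain and action given by `diracGraph`. -/
def dirac (m c α : ℝ) (V : ℝ → Matrix (Fin 2) (Fin 2) ℂ) : Spinor →ₗ.[ℂ] Spinor :=
  (diracGraph m c α V).toLinearPMap

/-- The graph of `dirac` is `diracGraph`: `diracGraph` is single-valued. -/
theorem dirac_graph (m c α : ℝ) (V : ℝ → Matrix (Fin 2) (Fin 2) ℂ) :
    (dirac m c α V).graph = diracGraph m c α V := by
  refine Submodule.toLinearPMap_graph_eq _ ?_
  rintro ⟨ψ, φ⟩ ⟨u₁, u₂, g₁, g₂, hu₁, hu₂, h1, h2, -, h4, h5⟩ (rfl : ψ = 0)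
  have z : ((0 : L2) : ℝ → ℂ) =ᵐ[halfLine] fun _ => 0 := Lp.coeFn_zero ℂ 2 halfLine
  have e1 := h1.symm.trans z
  have e2 := h2.symm.trans z
  have d1 := (hu₁.eq_zero e1).2
  have d2 := (hu₂.eq_zero e2).2
  have f1 : φ.fst = 0 := by
    refine Lp.ext (EventuallyEq.trans ?_ z.symm)
    filter_upwards [h4, e1, e2, d2] with x a1 a2 a3 a4
    refine a1.trans ?_
    simp [a2, a3, a4]
  have f2 : φ.snd = 0 := by
    refine Lp.ext (EventuallyEq.trans ?_ z.symm)
    filter_upwards [h5, e1, e2, d1] with x a1 a2 a3 a4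
    refine a1.trans ?_
    simp [a2, a3, a4]
  change φ = 0
  exact (WithLp.ofLp_injective 2) (Prod.ext f1 f2)

/-- The two boundary conditions at zero for the Laplacian on the half-line. -/
inductive BoundaryCondition
  | dirichlet
  | neumann

/-- The boundary condition in terms of the boundary values `u(0)` and `u'(0)`. -/
def BoundaryCondition.Holds (b : BoundaryCondition) (u0 u0' : ℂ) : Prop :=
  match b with
  | .dirichlet => u0 = 0
  | .neumann => u0' = 0

theorem BoundaryCondition.Holds.zero (b : BoundaryCondition) : b.Holds 0 0 := by
  cases b <;> rfl

theorem BoundaryCondition.Holds.add {b : BoundaryCondition} {x x' y y' : ℂ}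
    (h : b.Holds x x') (k : b.Holds y y') : b.Holds (x + y) (x' + y') := by
  cases b <;> simp_all [BoundaryCondition.Holds]

theorem BoundaryCondition.Holds.const_mul {b : BoundaryCondition} {x x' : ℂ} (a : ℂ)
    (h : b.Holds x x') : b.Holds (a * x) (a * x') := by
  cases b <;> simp_all [BoundaryCondition.Holds]

/-- The graph of the Schrödinger operator `s d²/dx² + q` on `L²(ℝ₊)` with boundary condition `b`
at zero. A pair `(ψ, φ)` belongs to the graph iff `ψ` is (represented by) a function `u` such that
`u` and `u' = v` are locally absolutely continuous on `[0, ∞)`, `u` satisfies the boundary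
condition, and `φ = s u'' + q u`. -/
def schrodingerGraph (s : ℝ) (q : ℝ → ℂ) (b : BoundaryCondition) : Submodule ℂ (L2 × L2) where
  carrier := {p | ∃ u v w : ℝ → ℂ, IsACWithDeriv u v ∧ IsACWithDeriv v w ∧
    p.1 =ᵐ[halfLine] u ∧ b.Holds (u 0) (v 0) ∧
    p.2 =ᵐ[halfLine] fun x => (s : ℂ) * w x + q x * u x}
  zero_mem' := by
    refine ⟨_, _, _, IsACWithDeriv.zero, IsACWithDeriv.zero, ?_, .zero b, ?_⟩
    · exact Lp.coeFn_zero ℂ 2 halfLine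
    · filter_upwards [Lp.coeFn_zero ℂ 2 halfLine] with x hx
      simpa using hx
  add_mem' := by
    rintro p r ⟨u, v, w, hu, hv, h1, h2, h3⟩ ⟨u', v', w', hu', hv', h1', h2', h3'⟩
    refine ⟨_, _, _, hu.add hu', hv.add hv', ?_, h2.add h2', ?_⟩
    · filter_upwards [Lp.coeFn_add p.1 r.1, h1, h1'] with x hx e e'
      rw [← e, ← e']; exact hx
    · filter_upwards [Lp.coeFn_add p.2 r.2, h3, h3'] with x hx e e'
      refine hx.trans ?_
      rw [Pi.add_apply, e, e']; ring
  smul_mem' := by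
    rintro a p ⟨u, v, w, hu, hv, h1, h2, h3⟩
    refine ⟨_, _, _, hu.const_mul a, hv.const_mul a, ?_, h2.const_mul a, ?_⟩
    · filter_upwards [Lp.coeFn_smul a p.1, h1] with x hx e
      rw [← e]; exact hx
    · filter_upwards [Lp.coeFn_smul a p.2, h3] with x hx e
      refine hx.trans ?_
      rw [Pi.smul_apply, e, smul_eq_mul]; ring

/-- The Schrödinger operator `s d²/dx² + q` on the half-line, with domain and action given by
`schrodingerGraph`. -/
def schrodinger (s : ℝ) (q : ℝ → ℂ) (b : BoundaryCondition) : L2 →ₗ.[ℂ] L2 :=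
  (schrodingerGraph s q b).toLinearPMap

/-- The graph of `schrodinger` is `schrodingerGraph`: `schrodingerGraph` is single-valued. -/
theorem schrodinger_graph (s : ℝ) (q : ℝ → ℂ) (b : BoundaryCondition) :
    (schrodinger s q b).graph = schrodingerGraph s q b := by
  refine Submodule.toLinearPMap_graph_eq _ ?_
  rintro ⟨ψ, φ⟩ ⟨u, v, w, hu, hv, h1, -, h3⟩ (rfl : ψ = 0)
  have z : ((0 : L2) : ℝ → ℂ) =ᵐ[halfLine] fun _ => 0 := Lp.coeFn_zero ℂ 2 halfLine
  have e1 := h1.symm.trans z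
  have e2 := (hu.eq_zero e1).2
  have e3 := (hv.eq_zero e2).2
  change φ = 0
  refine Lp.ext (EventuallyEq.trans ?_ z.symm)
  filter_upwards [h3, e1, e3] with x a1 a2 a3
  refine a1.trans ?_
  simp [a2, a3]

end HalfLineDirac

end

/-! For `D₀ + V + mc²` and the point `z = κ²/(2m)`, put `ε = 1/c`, `u = ψ₂` and `ψ₁ = ε(κ/2m)p`. The
resolvent equation turns into `u' = κp + O(ε)`, `p' = κu - (2m/κ)(V₂₂u - f₂) + O(ε)`. Nothing in it
is singular as `c → ∞`, and `ε = 0` gives exactly `u''/(2m) + V₂₂u - zu = f₂`. The boundary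
condition becomes `(1 - r)u(0) = (1 + r)p(0)` with a reflection coefficient `r` depending on `c`; `r
→ -1` is Dirichlet and `r = 1` is Neumann.

The free system is solved by explicit exponential kernels. Since `V` is only integrable, it is not a
bounded perturbation; the unknowns are therefore multiplied by `√(1 + w)` with `w ≥ |V_ij|`
integrable. By the Schur test (`exists_kernelOp`) the weighted kernels are bounded uniformly in `κ ≥
1`, and the weighted potential has norm at most 1. The solution operator `SystemData.sol` is then
norm continuous in `(ε, r)` wherever the inverse in it exists; at `ε = 0` it exists for large `κ`
(`norm_green_pert_zero_lt`), because the perturbation carries a factor `1/κ`.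

This gives right inverses. Injectivity comes from a Lagrange identity against solutions for the
transposed problem (`dirac_injective`, `schrodinger_injective`). Convergence at the single point `z`
spreads to the whole resolvent set by the resolvent identity (`normResolventTendsto_of_tendsto`).
The second limit follows from the first by charge conjugation (`ResolventTendstoAtPoint.conj`). -/

noncomputable section

namespace HalfLineDirac

/-! ### Calculus of locally absolutely continuous functions. -/

namespace IsACWithDeriv

variable {u v g h : ℝ → ℂ}

theorem integrableOn (hu : IsACWithDeriv u g) (b : ℝ) : IntegrableOn g (Ioc 0 b) := by
  rcases le_total 0 b with hb | hb
  · exact (intervalIntegrable_iff_integrableOn_Ioc_of_le hb).1 (hu.1 b hb)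
  · rw [Ioc_eq_empty (not_lt.2 hb)]; exact integrableOn_empty

theorem congr (hu : IsACWithDeriv u g) (huv : ∀ x, 0 ≤ x → v x = u x)
    (hgh : h =ᵐ[halfLine] g) : IsACWithDeriv v h := by
  have key : ∀ x, 0 ≤ x → ∀ᵐ t ∂volume.restrict (Ioc 0 x), h t = g t := fun x _ =>
    ae_restrict_of_ae_restrict_of_subset Ioc_subset_Ioi_self hgh
  refine ⟨fun b hb => ?_, fun x hx => ?_⟩
  · rw [intervalIntegrable_iff_integrableOn_Ioc_of_le hb]
    exact (hu.integrableOn b).congr_fun_ae (EventuallyEq.symm (key b hb))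
  · rw [huv x hx, huv 0 le_rfl, hu.2 x hx, intervalIntegral.integral_of_le hx,
      intervalIntegral.integral_of_le hx, integral_congr_ae (key x hx)]

theorem sub (hu : IsACWithDeriv u g) (hv : IsACWithDeriv v h) :
    IsACWithDeriv (fun x => u x - v x) (fun x => g x - h x) := by
  have := hu.add (hv.const_mul (-1))
  simpa [sub_eq_add_neg] using this

theorem const (a : ℂ) : IsACWithDeriv (fun _ => a) (fun _ => 0) :=
  ⟨fun _ _ => intervalIntegrable_const, fun _ _ => by simp⟩

theorem primitive (hg : ∀ b : ℝ, 0 ≤ b → IntervalIntegrable g volume 0 b) :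
    IsACWithDeriv (fun x => ∫ t in (0 : ℝ)..x, g t) g :=
  ⟨hg, fun _ _ => by simp⟩

theorem of_hasDerivAt (hu : ∀ x, HasDerivAt u (g x) x) (hg : Continuous g) :
    IsACWithDeriv u g :=
  ⟨fun b _ => hg.intervalIntegrable 0 b, fun x _ => by
    rw [intervalIntegral.integral_eq_sub_of_hasDerivAt (fun t _ => hu t)
      (hg.intervalIntegrable 0 x)]
    ring⟩

theorem intervalIntegrable_mul (hu : IsACWithDeriv u g) (hv : IsACWithDeriv v h) (b : ℝ)
    (hb : 0 ≤ b) : IntervalIntegrable (fun t => g t * v t) volume 0 b := by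
  refine (hu.1 b hb).mul_continuousOn (hv.continuousOn.mono ?_)
  rw [uIcc_of_le hb]; exact Icc_subset_Ici_self

/-- Fubini on a triangle. -/
theorem primitive_mul_primitive {x : ℝ} (hx : 0 ≤ x) (hg : IntegrableOn g (Ioc 0 x))
    (hh : IntegrableOn h (Ioc 0 x)) :
    (∫ t in (0 : ℝ)..x, g t) * (∫ t in (0 : ℝ)..x, h t) =
      (∫ t in (0 : ℝ)..x, g t * ∫ s in (0 : ℝ)..t, h s) +
        ∫ t in (0 : ℝ)..x, h t * ∫ s in (0 : ℝ)..t, g s := by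
  set μ := volume.restrict (Ioc 0 x) with hμ
  have hgi : Integrable g μ := hg
  have hhi : Integrable h μ := hh
  -- One half of the square is the closed triangle, the other its open complement; a set `S` known
  -- only up to null sets serves both.
  have key : ∀ k : ℝ → ℂ, ∀ t ∈ Ioc 0 x, ∀ S : Set ℝ, S =ᵐ[volume] Iic t →
      ∫ s in (0 : ℝ)..t, k s = ∫ s, S.indicator k s ∂μ := by
    intro k t ht S hS
    rw [intervalIntegral.integral_of_le ht.1.le]
    have e : S.indicator k =ᵐ[μ] (Iic t).indicator k :=
      ae_restrict_of_ae (indicator_ae_eq_of_ae_eq_set hS)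
    rw [integral_congr_ae e, integral_indicator measurableSet_Iic, hμ,
      Measure.restrict_restrict measurableSet_Iic]
    congr 2
    ext s
    simp only [mem_Ioc, mem_inter_iff, mem_Iic]
    exact ⟨fun q => ⟨q.2, q.1, q.2.trans ht.2⟩, fun q => ⟨q.2.1, q.1⟩⟩
  have hprod : Integrable (fun p : ℝ × ℝ => g p.1 * h p.2) (μ.prod μ) := hgi.mul_prod hhi
  have hms : MeasurableSet {p : ℝ × ℝ | p.2 ≤ p.1} := measurableSet_le measurable_snd measurable_fst
  rw [intervalIntegral.integral_of_le hx, intervalIntegral.integral_of_le hx,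
    intervalIntegral.integral_of_le hx, intervalIntegral.integral_of_le hx, ← hμ,
    ← integral_prod_mul, ← integral_add_compl hms hprod, ← integral_indicator hms,
    ← integral_indicator hms.compl]
  congr 1
  · rw [integral_prod _ (hprod.indicator hms)]
    refine setIntegral_congr_fun measurableSet_Ioc fun t ht => ?_
    rw [key h t ht (Iic t) (ae_eq_refl _), ← integral_const_mul]
    refine integral_congr_ae (ae_of_all _ fun s => ?_)
    by_cases hs : s ≤ t <;> simp [indicator, hs]
  · rw [integral_prod_symm _ (hprod.indicator hms.compl)]
    refine setIntegral_congr_fun measurableSet_Ioc fun t ht => ?_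
    rw [key g t ht (Iio t) Iio_ae_eq_Iic, ← integral_const_mul]
    refine integral_congr_ae (ae_of_all _ fun s => ?_)
    by_cases hs : s < t <;> simp [indicator, hs, mul_comm]

/-- After splitting off the values at 0, the product rule is `primitive_mul_primitive`. -/
theorem mul (hu : IsACWithDeriv u g) (hv : IsACWithDeriv v h) :
    IsACWithDeriv (fun x => u x * v x) (fun x => g x * v x + h x * u x) := by
  refine ⟨fun b hb => (hu.intervalIntegrable_mul hv b hb).add (hv.intervalIntegrable_mul hu b hb),
    fun x hx => ?_⟩
  have hi : ∀ {k l : ℝ → ℂ} (_ : IsACWithDeriv k l) (a b : ℝ → ℂ) (_ : IsACWithDeriv a b),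
      (∫ t in (0 : ℝ)..x, l t * a t) =
        (∫ t in (0 : ℝ)..x, l t) * a 0 + ∫ t in (0 : ℝ)..x, l t * ∫ s in (0 : ℝ)..t, b s := by
    intro k l hk a b ha
    rw [← intervalIntegral.integral_mul_const, ← intervalIntegral.integral_add
      ((hk.1 x hx).mul_const _) (hk.intervalIntegrable_mul (primitive ha.1) x hx)]
    refine intervalIntegral.integral_congr fun t ht => ?_
    rw [uIcc_of_le hx] at ht
    rw [ha.2 t ht.1]; ring
  rw [intervalIntegral.integral_add (hu.intervalIntegrable_mul hv x hx)
    (hv.intervalIntegrable_mul hu x hx), hi hu v h hv, hi hv u g hu]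
  have := primitive_mul_primitive hx (hu.integrableOn x) (hv.integrableOn x)
  rw [hu.2 x hx, hv.2 x hx]
  linear_combination this

/-- Variation of constants for `u' = l u + h`. -/
theorem exp_mul_primitive (l c : ℂ) (hh : ∀ b : ℝ, 0 ≤ b → IntervalIntegrable h volume 0 b) :
    IsACWithDeriv
      (fun x : ℝ => Complex.exp (l * x) * (c + ∫ t in (0 : ℝ)..x, Complex.exp (-(l * t)) * h t))
      (fun x : ℝ => l * (Complex.exp (l * x) *
        (c + ∫ t in (0 : ℝ)..x, Complex.exp (-(l * t)) * h t)) + h x) := by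
  have h1 : IsACWithDeriv (fun x : ℝ => Complex.exp (l * x))
      (fun x : ℝ => l * Complex.exp (l * x)) := by
    refine of_hasDerivAt (fun x => ?_) (by fun_prop)
    have := ((Complex.ofRealCLM.hasDerivAt (x := x)).const_mul l).cexp
    simpa [mul_comm] using this
  have h2 : IsACWithDeriv (fun x : ℝ => c + ∫ t in (0 : ℝ)..x, Complex.exp (-(l * t)) * h t)
      (fun t : ℝ => 0 + Complex.exp (-(l * t)) * h t) :=
    (const c).add (primitive fun b hb => (hh b hb).continuousOn_mul
      (Continuous.continuousOn (by fun_prop)))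
  refine (h1.mul h2).congr (fun x _ => rfl) (Eventually.of_forall fun x => ?_)
  have : Complex.exp (-(l * x)) * Complex.exp (l * x) = 1 := by
    rw [← Complex.exp_add]; simp
  simp only
  linear_combination (-h x) * this

theorem tendsto_atTop (hu : IsACWithDeriv u g) (hg : Integrable g halfLine) :
    Tendsto u atTop (𝓝 (u 0 + ∫ t, g t ∂halfLine)) := by
  have h1 := intervalIntegral_tendsto_integral_Ioi 0 (f := g) (μ := volume) hg tendsto_id
  refine (h1.const_add (u 0)).congr' ?_
  filter_upwards [eventually_ge_atTop 0] with x hx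
  exact (hu.2 x hx).symm

theorem eq_zero_of_integrable_of_tendsto {f : ℝ → ℂ} {a : ℂ} (hf : Integrable f halfLine)
    (h : Tendsto f atTop (𝓝 a)) : a = 0 := by
  refine IntegrableAtFilter.eq_zero_of_tendsto (l := atTop) (μ := volume) (f := f)
    ⟨Ioi 0, Ioi_mem_atTop 0, hf⟩ (fun s hs => ?_) h
  obtain ⟨b, hb⟩ := mem_atTop_sets.1 hs
  refine measure_mono_top (show Ioi b ⊆ s from fun y hy => hb y (le_of_lt hy)) ?_
  simp

/-- If `u` and its derivative are integrable on the half-line, then the derivative integrates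
to `-u(0)`. -/
theorem integral_deriv_eq (hu : IsACWithDeriv u g) (hui : Integrable u halfLine)
    (hg : Integrable g halfLine) : ∫ t, g t ∂halfLine = -u 0 := by
  have := eq_zero_of_integrable_of_tendsto hui (hu.tendsto_atTop hg)
  linear_combination this

end IsACWithDeriv

/-! ### Bounded operators on `L²(ℝ₊)` -/

theorem exists_mulOp {g : ℝ → ℂ} {C : ℝ} (hg : AEStronglyMeasurable g halfLine)
    (hC : 0 ≤ C) (hgC : ∀ᵐ x ∂halfLine, ‖g x‖ ≤ C) :
    ∃ M : L2 →L[ℂ] L2, ‖M‖ ≤ C ∧ ∀ f : L2, M f =ᵐ[halfLine] fun x => g x * f x := by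
  have hm : MemLp g ⊤ halfLine := memLp_top_of_bound hg C hgC
  refine ⟨(ContinuousLinearMap.mul ℂ ℂ).holderL halfLine ⊤ 2 2 hm.toLp, ?_, fun f => ?_⟩
  · have h1 : ‖hm.toLp‖ ≤ C := by
      rw [Lp.norm_toLp]
      refine ENNReal.toReal_le_of_le_ofReal hC ?_
      rw [eLpNorm_exponent_top]
      exact eLpNormEssSup_le_of_ae_bound hgC
    refine ContinuousLinearMap.opNorm_le_bound _ hC fun f => ?_
    refine ((ContinuousLinearMap.mul ℂ ℂ).norm_holder_apply_apply_le hm.toLp f).trans ?_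
    have h2 : ‖ContinuousLinearMap.mul ℂ ℂ‖ ≤ 1 := ContinuousLinearMap.opNorm_mul_le ℂ ℂ
    calc _ ≤ 1 * C * ‖f‖ := by gcongr
      _ = _ := by ring
  · have h1 := (ContinuousLinearMap.mul ℂ ℂ).coeFn_holder (r := 2) hm.toLp f
    filter_upwards [h1, hm.coeFn_toLp] with x hx h2
    refine hx.trans ?_
    rw [h2]; rfl

/-! ### The weighted Schur test. -/

/-- A measurable, nonnegative, integrable function. -/
structure IsWeight (w : ℝ → ℝ) : Prop where
  measurable : Measurable w
  nonneg : ∀ x, 0 ≤ w x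
  integrable : Integrable w halfLine

/-- The weight `√(1 + w)` that is used to symmetrize integral operators. -/
def sqrtWeight (w : ℝ → ℝ) (x : ℝ) : ℝ := √(1 + w x)

theorem sqrtWeight_nonneg (w : ℝ → ℝ) (x : ℝ) : 0 ≤ sqrtWeight w x := Real.sqrt_nonneg _

theorem IsWeight.measurable_sqrtWeight {w : ℝ → ℝ} (hw : IsWeight w) :
    Measurable (sqrtWeight w) :=
  (measurable_const.add hw.measurable).sqrt

theorem IsWeight.sq_sqrtWeight {w : ℝ → ℝ} (hw : IsWeight w) (x : ℝ) :
    sqrtWeight w x ^ 2 = 1 + w x :=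
  Real.sq_sqrt (by linarith [hw.nonneg x])

theorem IsWeight.one_le_sqrtWeight {w : ℝ → ℝ} (hw : IsWeight w) (x : ℝ) :
    1 ≤ sqrtWeight w x :=
  Real.one_le_sqrt.2 (by linarith [hw.nonneg x])

/-- The kernel `exp (-|x - y|)`, with values in `[0, ∞]`. -/
def expKer (x y : ℝ) : ENNReal := ENNReal.ofReal (Real.exp (-|x - y|))

theorem measurable_expKer : Measurable (Function.uncurry expKer) := by
  unfold Function.uncurry expKer; fun_prop

theorem expKer_comm (x y : ℝ) : expKer x y = expKer y x := by
  simp [expKer, abs_sub_comm]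

/-- The constant in the Schur test for the kernel `exp (-|x - y|)` with respect to the measure
`(1 + w) dx`. -/
def schurConst (w : ℝ → ℝ) : ENNReal :=
  (∫⁻ t, ENNReal.ofReal (Real.exp (-|t|))) + ∫⁻ t, ENNReal.ofReal (w t) ∂halfLine

theorem IsWeight.schurConst_ne_top {w : ℝ → ℝ} (hw : IsWeight w) : schurConst w ≠ ⊤ := by
  refine ENNReal.add_ne_top.2 ⟨?_, ?_⟩
  · have h : Integrable fun t : ℝ => Real.exp (-|t|) := by
      rw [← integrableOn_univ, ← Iic_union_Ioi (a := (0 : ℝ))]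
      refine IntegrableOn.union ?_ ?_
      · refine (integrableOn_exp_Iic 0).congr_fun (fun t ht => ?_) measurableSet_Iic
        simp [abs_of_nonpos (mem_Iic.1 ht)]
      · refine (integrableOn_exp_neg_Ioi 0).congr_fun (fun t ht => ?_) measurableSet_Ioi
        simp [abs_of_pos (mem_Ioi.1 ht)]
    exact h.lintegral_lt_top.ne
  · exact hw.integrable.lintegral_lt_top.ne

/-- The `1` in `1 + w` is integrated against the exponential, and on `w` the exponential is bounded
by 1. The bound depends neither on `x` nor on `κ`. -/
theorem IsWeight.lintegral_expKer_le {w : ℝ → ℝ} (hw : IsWeight w) (x : ℝ) :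
    ∫⁻ y, expKer x y * ENNReal.ofReal (sqrtWeight w y) ^ 2 ∂halfLine ≤ schurConst w := by
  have h1 : ∀ y, expKer x y * ENNReal.ofReal (sqrtWeight w y) ^ 2 ≤
      ENNReal.ofReal (Real.exp (-|x - y|)) + ENNReal.ofReal (w y) := by
    intro y
    rw [← ENNReal.ofReal_pow (sqrtWeight_nonneg w y), hw.sq_sqrtWeight, expKer,
      ← ENNReal.ofReal_mul (Real.exp_pos _).le, ← ENNReal.ofReal_add (Real.exp_pos _).le (hw.nonneg y)]
    refine ENNReal.ofReal_le_ofReal ?_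
    have : Real.exp (-|x - y|) ≤ 1 := Real.exp_le_one_iff.2 (by simp)
    nlinarith [hw.nonneg y]
  refine (lintegral_mono h1).trans ?_
  rw [lintegral_add_left (by fun_prop)]
  refine add_le_add ((setLIntegral_le_lintegral _ _).trans_eq ?_) le_rfl
  exact lintegral_sub_left_eq_self (fun t => ENNReal.ofReal (Real.exp (-|t|))) x

/-- Cauchy–Schwarz for the measure with density `e`. -/
theorem sq_lintegral_mul_le {α : Type*} [MeasurableSpace α] {μ : Measure α} {e a b : α → ENNReal}
    (he : Measurable e) (ha : AEMeasurable a μ) (hb : AEMeasurable b μ) :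
    (∫⁻ y, e y * (a y * b y) ∂μ) ^ 2 ≤ (∫⁻ y, e y * a y ^ 2 ∂μ) * ∫⁻ y, e y * b y ^ 2 ∂μ := by
  have hac := withDensity_absolutelyContinuous μ e
  have h := ENNReal.lintegral_mul_le_Lp_mul_Lq (μ.withDensity e) Real.HolderConjugate.two_two
    (ha.mono_ac hac) (hb.mono_ac hac)
  have key : ∀ f : α → ENNReal, AEMeasurable f μ →
      ∫⁻ y, f y ∂μ.withDensity e = ∫⁻ y, e y * f y ∂μ := fun f hf => by
    rw [lintegral_withDensity_eq_lintegral_mul₀ he.aemeasurable hf]; rfl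
  rw [key _ (ha.mul hb), key _ (ha.pow_const _), key _ (hb.pow_const _)] at h
  have h2 := ENNReal.rpow_le_rpow h (z := 2) (by norm_num)
  rw [ENNReal.mul_rpow_of_nonneg _ _ (by norm_num), ← ENNReal.rpow_mul, ← ENNReal.rpow_mul] at h2
  simpa using h2

theorem eLpNorm_two_le_of_lintegral {f g : ℝ → ℂ} {μ : Measure ℝ} {C : ENNReal}
    (h : ∫⁻ x, ‖g x‖ₑ ^ 2 ∂μ ≤ C ^ 2 * ∫⁻ x, ‖f x‖ₑ ^ 2 ∂μ) :
    eLpNorm g 2 μ ≤ C * eLpNorm f 2 μ := by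
  have e : ∀ k : ℝ → ℂ, eLpNorm k 2 μ = (∫⁻ x, ‖k x‖ₑ ^ 2 ∂μ) ^ (1 / 2 : ℝ) := by
    intro k
    rw [eLpNorm_eq_lintegral_rpow_enorm_toReal (by norm_num) (by norm_num)]
    simp
  rw [e, e]
  refine (ENNReal.rpow_le_rpow h (by norm_num)).trans_eq ?_
  rw [ENNReal.mul_rpow_of_nonneg _ _ (by norm_num)]
  congr 1
  rw [← ENNReal.rpow_natCast, ← ENNReal.rpow_mul]
  norm_num

/-- Measurable kernels that are dominated by `exp (-|x - y|)`. -/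
structure IsExpKernel (k : ℝ → ℝ → ℂ) : Prop where
  measurable : Measurable (Function.uncurry k)
  norm_le : ∀ x y, ‖k x y‖ ≤ Real.exp (-|x - y|)

theorem IsExpKernel.enorm_le {k : ℝ → ℝ → ℂ} (hk : IsExpKernel k) (x y : ℝ) :
    ‖k x y‖ₑ ≤ expKer x y := by
  rw [← ofReal_norm]
  exact ENNReal.ofReal_le_ofReal (hk.norm_le x y)

section Kernel

variable {w : ℝ → ℝ} (hw : IsWeight w) {k : ℝ → ℝ → ℂ} (hk : IsExpKernel k)

theorem enorm_sqrtWeight (w : ℝ → ℝ) (x : ℝ) :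
    ‖(sqrtWeight w x : ℂ)‖ₑ = ENNReal.ofReal (sqrtWeight w x) := by
  rw [← ofReal_norm, Complex.norm_real, Real.norm_of_nonneg (sqrtWeight_nonneg w x)]

include hw in
-- First half of the Schur test: in Cauchy–Schwarz the whole weight goes to the factor without `f`.
theorem sq_lintegral_expKer_le (f : L2) (x : ℝ) :
    (∫⁻ y, expKer x y * (ENNReal.ofReal (sqrtWeight w y) * ‖f y‖ₑ) ∂halfLine) ^ 2 ≤
      schurConst w * ∫⁻ y, expKer x y * ‖f y‖ₑ ^ 2 ∂halfLine := by
  refine (sq_lintegral_mul_le (measurable_expKer.comp measurable_prodMk_left)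
    hw.measurable_sqrtWeight.ennreal_ofReal.aemeasurable
    (Lp.stronglyMeasurable f).enorm.aemeasurable).trans ?_
  exact mul_le_mul_left (hw.lintegral_expKer_le x) _

theorem lintegral_enorm_sq_ne_top (f : L2) : ∫⁻ y, ‖f y‖ₑ ^ 2 ∂halfLine ≠ ⊤ := by
  have h := (Lp.memLp f).2
  rw [eLpNorm_eq_lintegral_rpow_enorm_toReal (by norm_num) (by norm_num)] at h
  have := (ENNReal.rpow_lt_top_iff_of_pos (by norm_num)).1 h
  simpa using this.ne

include hw in
theorem lintegral_expKer_lt_top (f : L2) (x : ℝ) :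
    ∫⁻ y, expKer x y * (ENNReal.ofReal (sqrtWeight w y) * ‖f y‖ₑ) ∂halfLine < ⊤ := by
  have h1 : ∫⁻ y, expKer x y * ‖f y‖ₑ ^ 2 ∂halfLine ≤ ∫⁻ y, ‖f y‖ₑ ^ 2 ∂halfLine := by
    refine lintegral_mono fun y => mul_le_of_le_one_left (by simp) ?_
    rw [expKer]
    exact ENNReal.ofReal_le_one.2 (Real.exp_le_one_iff.2 (by simp))
  have h2 := (sq_lintegral_expKer_le hw f x).trans_lt (ENNReal.mul_lt_top hw.schurConst_ne_top.lt_top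
    (h1.trans_lt (lintegral_enorm_sq_ne_top f).lt_top))
  exact (ENNReal.pow_lt_top_iff.1 h2).resolve_right (by norm_num)

include hw hk in
theorem integrable_kernel_mul (f : L2) (x : ℝ) :
    Integrable (fun y => k x y * (sqrtWeight w y * f y)) halfLine := by
  have hm : Measurable fun y => (sqrtWeight w y : ℂ) :=
    Complex.measurable_ofReal.comp hw.measurable_sqrtWeight
  refine ⟨((hk.measurable.comp measurable_prodMk_left).mul
    (hm.mul (Lp.stronglyMeasurable f).measurable)).aestronglyMeasurable, ?_⟩
  refine lt_of_le_of_lt (lintegral_mono fun y => ?_) (lintegral_expKer_lt_top hw f x)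
  rw [enorm_mul, enorm_mul, enorm_sqrtWeight]
  exact mul_le_mul_left (hk.enorm_le x y) _

include hw hk in
theorem measurable_kernel_integral (f : L2) :
    StronglyMeasurable fun x : ℝ =>
      (sqrtWeight w x : ℂ) * ∫ y, k x y * (sqrtWeight w y * f y) ∂halfLine := by
  have hm : Measurable fun y => (sqrtWeight w y : ℂ) :=
    Complex.measurable_ofReal.comp hw.measurable_sqrtWeight
  refine hm.stronglyMeasurable.mul (StronglyMeasurable.integral_prod_right ?_)
  exact (hk.measurable.mul ((hm.comp measurable_snd).mul
    ((Lp.stronglyMeasurable f).measurable.comp measurable_snd))).stronglyMeasurable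

include hw hk in
-- Second half of the Schur test: Tonelli, then the symmetry of `expKer` allows the same row bound
-- to be used in the other variable.
theorem lintegral_kernel_le (f : L2) :
    ∫⁻ x, ‖(sqrtWeight w x : ℂ) * ∫ y, k x y * (sqrtWeight w y * f y) ∂halfLine‖ₑ ^ 2 ∂halfLine ≤
      schurConst w ^ 2 * ∫⁻ x, ‖f x‖ₑ ^ 2 ∂halfLine := by
  have h1 : ∀ x, ‖(sqrtWeight w x : ℂ) * ∫ y, k x y * (sqrtWeight w y * f y) ∂halfLine‖ₑ ^ 2 ≤
      schurConst w * ∫⁻ y, ENNReal.ofReal (sqrtWeight w x) ^ 2 *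
        (expKer x y * ‖f y‖ₑ ^ 2) ∂halfLine := by
    intro x
    rw [enorm_mul, mul_pow, enorm_sqrtWeight, lintegral_const_mul' _ _ (by simp), mul_left_comm]
    refine mul_le_mul_right (le_trans (pow_le_pow_left₀ (by simp) ?_ 2)
      (sq_lintegral_expKer_le hw f x)) _
    refine (enorm_integral_le_lintegral_enorm _).trans (lintegral_mono fun y => ?_)
    rw [enorm_mul, enorm_mul, enorm_sqrtWeight]
    exact mul_le_mul_left (hk.enorm_le x y) _
  have hmw := hw.measurable_sqrtWeight.ennreal_ofReal
  have hmf := (Lp.stronglyMeasurable f).enorm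
  refine (lintegral_mono h1).trans ?_
  rw [lintegral_const_mul' _ _ hw.schurConst_ne_top, sq, mul_assoc]
  refine mul_le_mul_right ?_ _
  rw [lintegral_lintegral_swap]
  · rw [← lintegral_const_mul' _ _ hw.schurConst_ne_top]
    refine lintegral_mono fun y => ?_
    have : ∀ x, ENNReal.ofReal (sqrtWeight w x) ^ 2 * (expKer x y * ‖f y‖ₑ ^ 2) =
        expKer y x * ENNReal.ofReal (sqrtWeight w x) ^ 2 * ‖f y‖ₑ ^ 2 := fun x => by
      rw [expKer_comm]; ring
    simp_rw [this]
    rw [lintegral_mul_const' _ _ (by simp)]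
    exact mul_le_mul_left (hw.lintegral_expKer_le y) _
  · refine Measurable.aemeasurable ?_
    exact ((hmw.comp measurable_fst).pow_const 2).mul
      (measurable_expKer.mul ((hmf.comp measurable_snd).pow_const 2))

include hw hk in
/-- Schur test: the integral operator with kernel `√(1 + w(x)) k(x, y) √(1 + w(y))` is bounded. -/
theorem exists_kernelOp :
    ∃ T : L2 →L[ℂ] L2, ‖T‖ ≤ (schurConst w).toReal ∧ ∀ f : L2, T f =ᵐ[halfLine] fun x =>
      (sqrtWeight w x : ℂ) * ∫ y, k x y * (sqrtWeight w y * f y) ∂halfLine := by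
  set F : L2 → ℝ → ℂ := fun f x =>
      (sqrtWeight w x : ℂ) * ∫ y, k x y * (sqrtWeight w y * f y) ∂halfLine with hF
  have hle : ∀ f : L2, eLpNorm (F f) 2 halfLine ≤ schurConst w * eLpNorm f 2 halfLine :=
    fun f => eLpNorm_two_le_of_lintegral (lintegral_kernel_le hw hk f)
  have hmem : ∀ f : L2, MemLp (F f) 2 halfLine := fun f =>
    ⟨(measurable_kernel_integral hw hk f).aestronglyMeasurable, (hle f).trans_lt
      (ENNReal.mul_lt_top hw.schurConst_ne_top.lt_top (Lp.memLp f).2)⟩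
  -- This holds at every `x`, not just almost everywhere: the integral exists for each `x` and sees
  -- only the class of `f`.
  have hadd : ∀ f g : L2, F (f + g) = F f + F g := by
    intro f g
    ext x
    simp only [hF, Pi.add_apply]
    rw [← mul_add, ← integral_add (integrable_kernel_mul hw hk f x)
      (integrable_kernel_mul hw hk g x)]
    congr 1
    refine integral_congr_ae ?_
    filter_upwards [Lp.coeFn_add f g] with y hy
    rw [hy, Pi.add_apply]; ring
  have hsmul : ∀ (a : ℂ) (f : L2), F (a • f) = a • F f := by
    intro a f
    ext x
    simp only [hF, Pi.smul_apply, smul_eq_mul]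
    rw [mul_left_comm a, ← integral_const_mul a]
    congr 1
    refine integral_congr_ae ?_
    filter_upwards [Lp.coeFn_smul a f] with y hy
    rw [hy, Pi.smul_apply, smul_eq_mul]; ring
  let T : L2 →ₗ[ℂ] L2 :=
    { toFun := fun f => (hmem f).toLp
      map_add' := fun f g => by
        rw [← MemLp.toLp_add]; exact MemLp.toLp_congr _ _ (by rw [hadd])
      map_smul' := fun a f => by
        rw [RingHom.id_apply, ← MemLp.toLp_const_smul]; exact MemLp.toLp_congr _ _ (by rw [hsmul]) }
  have hbd : ∀ f, ‖T f‖ ≤ (schurConst w).toReal * ‖f‖ := by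
    intro f
    change ‖(hmem f).toLp‖ ≤ _
    rw [Lp.norm_toLp, Lp.norm_def, ← ENNReal.toReal_mul]
    exact ENNReal.toReal_mono (ENNReal.mul_ne_top hw.schurConst_ne_top (Lp.memLp f).2.ne) (hle f)
  refine ⟨T.mkContinuous _ hbd, T.mkContinuous_norm_le ENNReal.toReal_nonneg _, fun f => ?_⟩
  exact (hmem f).coeFn_toLp

end Kernel

/-! ### Resolvents -/

section AbstractResolvent

variable {E : Type*} [NormedAddCommGroup E] [NormedSpace ℂ E]

/-- The differential operators are given by their graphs, so resolvents are handled without mention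
of domains. -/
theorem isResolventAt_iff_graph {T : E →ₗ.[ℂ] E} {z : ℂ} {R : E →L[ℂ] E} :
    IsResolventAt T z R ↔ (∀ x y, (x, y) ∈ T.graph → R (y - z • x) = x) ∧
      ∀ y, (R y, y + z • R y) ∈ T.graph := by
  constructor
  · intro h
    refine ⟨fun x y hxy => ?_, fun y => ?_⟩
    · obtain ⟨a, ha, hb⟩ := (LinearPMap.mem_graph_iff _).1 hxy
      simp only at ha hb
      rw [← ha, ← hb]; exact h.left_inv a
    · obtain ⟨x, hx, hy⟩ := h.right_inv y
      refine (LinearPMap.mem_graph_iff _).2 ⟨x, hx, ?_⟩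
      simp only
      rw [← hx, ← hy]; abel
  · rintro ⟨h1, h2⟩
    refine ⟨fun x => h1 _ _ (T.mem_graph x), fun y => ?_⟩
    obtain ⟨a, ha, hb⟩ := (LinearPMap.mem_graph_iff _).1 (h2 y)
    simp only at ha hb
    exact ⟨a, ha, by rw [ha, hb]; abel⟩

theorem mem_graph_addConst {T : E →ₗ.[ℂ] E} {w : ℂ} {x y : E} :
    (x, y) ∈ (addConst T w).graph ↔ (x, y - w • x) ∈ T.graph := by
  simp only [LinearPMap.mem_graph_iff]
  constructor
  · rintro ⟨a, ha, hb⟩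
    refine ⟨⟨a, a.2⟩, ha, ?_⟩
    rw [← hb, ← ha]
    change _ = (w • (a : E) + T ⟨a, a.2⟩) - _
    abel
  · rintro ⟨a, ha, hb⟩
    have hb : T a = y - w • x := hb
    have ha : (a : E) = x := ha
    refine ⟨⟨a, a.2⟩, ha, ?_⟩
    change w • (a : E) + T a = y
    rw [hb, ha]; abel

/-- Surjectivity and injectivity of `T - z` give the resolvent. -/
theorem IsResolventAt.of_graph {T : E →ₗ.[ℂ] E} {z : ℂ} {R : E →L[ℂ] E}
    (hinj : ∀ x, (x, z • x) ∈ T.graph → x = 0) (hR : ∀ y, (R y, y + z • R y) ∈ T.graph) :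
    IsResolventAt T z R := by
  refine isResolventAt_iff_graph.2 ⟨fun x y hxy => ?_, hR⟩
  have h := T.graph.sub_mem (hR (y - z • x)) hxy
  rw [← sub_eq_zero]
  refine hinj _ ?_
  have e : (R (y - z • x) - x, z • (R (y - z • x) - x)) =
      (R (y - z • x), y - z • x + z • R (y - z • x)) - (x, y) :=
    Prod.ext rfl (by simp only [Prod.mk_sub_mk, smul_sub]; abel)
  rwa [e]

/-- The first resolvent identity, solved for the resolvent at the new point. -/
theorem IsResolventAt.of_inverse {T : E →ₗ.[ℂ] E} {z₀ z : ℂ} {Q P : E →L[ℂ] E}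
    (h : IsResolventAt T z₀ Q) (h1 : (1 - (z - z₀) • Q) * P = 1)
    (h2 : P * (1 - (z - z₀) • Q) = 1) : IsResolventAt T z (Q * P) := by
  obtain ⟨hl, hr⟩ := isResolventAt_iff_graph.1 h
  have hc : (1 - (z - z₀) • Q) * Q = Q * (1 - (z - z₀) • Q) := by
    simp [sub_mul, mul_sub]
  -- `Q` commutes with `1 - (z - z₀)Q`, hence with its inverse `P`.
  have hPQ : P * Q = Q * P := by
    calc P * Q = P * Q * ((1 - (z - z₀) • Q) * P) := by rw [h1, mul_one]
      _ = P * (Q * (1 - (z - z₀) • Q)) * P := by simp only [mul_assoc]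
      _ = P * (1 - (z - z₀) • Q) * (Q * P) := by rw [← hc]; simp only [mul_assoc]
      _ = Q * P := by rw [h2, one_mul]
  refine isResolventAt_iff_graph.2 ⟨fun x y hxy => ?_, fun y => ?_⟩
  · rw [← hPQ]
    have e1 : Q (y - z • x) = (1 - (z - z₀) • Q) x := by
      have e : y - z • x = (y - z₀ • x) - (z - z₀) • x := by rw [sub_smul]; abel
      rw [e, map_sub, hl x y hxy]
      simp
    change P (Q (y - z • x)) = x
    rw [e1, ← mul_apply_eq_comp, h2]
    rfl
  · have e2 : y = P y - (z - z₀) • Q (P y) := by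
      have := congrArg (fun L : E →L[ℂ] E => L y) h1
      simpa using this.symm
    have e3 : y + z • (Q * P) y = P y + z₀ • Q (P y) := by
      nth_rewrite 1 [e2]
      change _ + z • Q (P y) = _
      rw [sub_smul]; abel
    rw [e3]
    exact hr (P y)

/-- The resolvent identity in the form `(1 - (z - z₀) R(z₀)) (1 + (z - z₀) R(z)) = 1`. -/
theorem IsResolventAt.resolvent_identity {T : E →ₗ.[ℂ] E} {z₀ z : ℂ} {R₀ R : E →L[ℂ] E}
    (h₀ : IsResolventAt T z₀ R₀) (h : IsResolventAt T z R) :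
    R = R₀ + (z - z₀) • (R₀ * R) := by
  obtain ⟨hl, -⟩ := isResolventAt_iff_graph.1 h₀
  obtain ⟨-, hr⟩ := isResolventAt_iff_graph.1 h
  ext y
  have h1 := hl _ _ (hr y)
  have e : y + z • R y - z₀ • R y = y + (z - z₀) • R y := by rw [sub_smul]; abel
  rw [e, map_add, map_smul] at h1
  exact h1.symm

variable {F : Type*} [NormedAddCommGroup F] [NormedSpace ℂ F]

/-- Convergence of the resolvents at one point of the resolvent set of the limit gives
norm-resolvent convergence. -/
theorem normResolventTendsto_of_tendsto [CompleteSpace E] {T : ℝ → E →ₗ.[ℂ] E} {S : F →ₗ.[ℂ] F}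
    {J : (F →L[ℂ] F) → (E →L[ℂ] E)} (hadd : ∀ A B, J (A + B) = J A + J B)
    (hsmul : ∀ (a : ℂ) A, J (a • A) = a • J A) (hmul : ∀ A B, J (A * B) = J A * J B)
    {z₀ : ℂ} {R₀ : F →L[ℂ] F} (hS : IsResolventAt S z₀ R₀) {Q : ℝ → E →L[ℂ] E}
    (hT : ∀ᶠ c in atTop, IsResolventAt (T c) z₀ (Q c)) (hQ : Tendsto Q atTop (𝓝 (J R₀))) :
    NormResolventTendsto T S J := by
  refine ⟨⟨z₀, R₀, hS⟩, fun z hz => ?_⟩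
  have hR := isResolventAt_resolvent hz
  set R := resolvent S z with hRdef
  have i1 := hS.resolvent_identity hR
  have i2 := hR.resolvent_identity hS
  have j1 : J R = J R₀ + (z - z₀) • (J R₀ * J R) := by
    rw [← hmul, ← hsmul, ← hadd, ← i1]
  have j2 : J R₀ = J R + (z₀ - z) • (J R * J R₀) := by
    rw [← hmul, ← hsmul, ← hadd, ← i2]
  -- `J` is multiplicative but need not preserve 1. The image `J R` still satisfies both resolvent
  -- identities, and these exhibit an explicit inverse of `1 - (z - z₀) J R₀`. As units are open and
  -- inversion is continuous, `1 - (z - z₀) Q c` is invertible for large `c` with convergent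
  -- inverse.
  let U : (E →L[ℂ] E)ˣ :=
    { val := 1 - (z - z₀) • J R₀
      inv := 1 + (z - z₀) • J R
      val_inv := by
        have : (1 - (z - z₀) • J R₀) * (1 + (z - z₀) • J R) =
            1 + (z - z₀) • (J R - (J R₀ + (z - z₀) • (J R₀ * J R))) := by
          simp only [sub_mul, mul_add, one_mul, mul_one, smul_mul_assoc, mul_smul_comm, smul_sub,
            smul_add]
          abel
        rw [this, ← j1]; simp
      inv_val := by
        have : (1 + (z - z₀) • J R) * (1 - (z - z₀) • J R₀) =
            1 - (z - z₀) • (J R₀ - (J R + (z₀ - z) • (J R * J R₀))) := by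
          rw [← neg_sub z z₀]
          simp only [add_mul, mul_sub, one_mul, mul_one, smul_mul_assoc, mul_smul_comm, smul_sub,
            smul_add, neg_smul, smul_neg]
          abel
        rw [this, ← j2]; simp }
  have hlim : Tendsto (fun c => 1 - (z - z₀) • Q c) atTop (𝓝 (U : E →L[ℂ] E)) :=
    tendsto_const_nhds.sub (hQ.const_smul _)
  have hunit : ∀ᶠ c in atTop, IsUnit (1 - (z - z₀) • Q c) :=
    hlim.eventually (Units.isOpen.mem_nhds U.isUnit)
  have hres : ∀ᶠ c in atTop,
      IsResolventAt (T c) z (Q c * Ring.inverse (1 - (z - z₀) • Q c)) := by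
    filter_upwards [hT, hunit] with c h1 h2
    exact h1.of_inverse (Ring.mul_inverse_cancel _ h2) (Ring.inverse_mul_cancel _ h2)
  refine ⟨hres.mono fun c hc => ⟨_, hc⟩, ?_⟩
  have hinv := (NormedRing.inverse_continuousAt U).tendsto.comp hlim
  rw [Ring.inverse_unit] at hinv
  have hfin := hQ.mul hinv
  have e : J R₀ * ((U⁻¹ : (E →L[ℂ] E)ˣ) : E →L[ℂ] E) = J R := by
    change J R₀ * (1 + (z - z₀) • J R) = J R
    rw [mul_add, mul_one, mul_smul_comm, ← j1]
  rw [e] at hfin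
  refine hfin.congr' ?_
  filter_upwards [hres] with c hc
  exact hc.unique (isResolventAt_resolvent ⟨_, hc⟩)

end AbstractResolvent

section DirectSum

theorem Spinor.ext {x y : Spinor} (h1 : x.fst = y.fst) (h2 : x.snd = y.snd) : x = y :=
  WithLp.ofLp_injective 2 (Prod.ext h1 h2)

theorem directSum_add (A B A' B' : L2 →L[ℂ] L2) :
    directSum (A + A') (B + B') = directSum A B + directSum A' B' := rfl

theorem directSum_smul (a : ℂ) (A B : L2 →L[ℂ] L2) :
    directSum (a • A) (a • B) = a • directSum A B := rfl

theorem directSum_mul (A B A' B' : L2 →L[ℂ] L2) :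
    directSum (A * A') (B * B') = directSum A B * directSum A' B' := rfl

end DirectSum

/-! ### The free first-order system `u' = κ p + h₁`, `p' = κ u + h₂` -/

/-- Kernel of the decaying solution operator of `a' = κ a + h`. -/
def growKer (κ x y : ℝ) : ℂ := if x < y then -(Real.exp (-(κ * (y - x))) : ℂ) else 0

/-- Kernel of the solution operator of `b' = -κ b + h`, `b(0) = 0`. -/
def decayKer (κ x y : ℝ) : ℂ := if y < x then (Real.exp (-(κ * (x - y))) : ℂ) else 0

/-- Kernel of the reflected wave, the solution of `e' = -κ e` with the initial value of
`growKer`. -/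
def reflKer (κ x y : ℝ) : ℂ := -(Real.exp (-(κ * (|x| + |y|))) : ℂ)

section Kernels

variable {κ : ℝ}

theorem isExpKernel_growKer (hκ : 1 ≤ κ) : IsExpKernel (growKer κ) := by
  refine ⟨?_, fun x y => ?_⟩
  · refine Measurable.ite (measurableSet_lt measurable_fst measurable_snd) ?_ measurable_const
    fun_prop
  · unfold growKer
    split_ifs with h
    · rw [norm_neg, Complex.norm_real, Real.norm_of_nonneg (Real.exp_pos _).le, Real.exp_le_exp,
        abs_of_neg (sub_neg.2 h)]
      nlinarith
    · simp [(Real.exp_pos _).le]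

theorem isExpKernel_decayKer (hκ : 1 ≤ κ) : IsExpKernel (decayKer κ) := by
  refine ⟨?_, fun x y => ?_⟩
  · refine Measurable.ite (measurableSet_lt measurable_snd measurable_fst) ?_ measurable_const
    fun_prop
  · unfold decayKer
    split_ifs with h
    · rw [Complex.norm_real, Real.norm_of_nonneg (Real.exp_pos _).le, Real.exp_le_exp,
        abs_of_pos (sub_pos.2 h)]
      nlinarith
    · simp [(Real.exp_pos _).le]

theorem isExpKernel_reflKer (hκ : 1 ≤ κ) : IsExpKernel (reflKer κ) := by
  refine ⟨?_, fun x y => ?_⟩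
  · unfold Function.uncurry reflKer
    fun_prop
  · unfold reflKer
    rw [norm_neg, Complex.norm_real, Real.norm_of_nonneg (Real.exp_pos _).le, Real.exp_le_exp]
    -- The absolute values in `reflKer` make the domination hold on all of `ℝ × ℝ`, where
    -- `IsExpKernel` demands it.
    have := abs_sub x y
    nlinarith [abs_nonneg x, abs_nonneg y]

theorem reflKer_isAC (κ : ℝ) (w : ℝ → ℝ) (f : L2) :
    IsACWithDeriv (fun x => ∫ y, reflKer κ x y * (sqrtWeight w y * f y) ∂halfLine)
      (fun x => -κ * ∫ y, reflKer κ x y * (sqrtWeight w y * f y) ∂halfLine) ∧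
    ∫ y, reflKer κ 0 y * (sqrtWeight w y * f y) ∂halfLine =
      ∫ y, growKer κ 0 y * (sqrtWeight w y * f y) ∂halfLine := by
  set h : ℝ → ℂ := fun y => sqrtWeight w y * f y with hh
  have key : ∀ x, 0 ≤ x → ∫ y, reflKer κ x y * h y ∂halfLine =
      Complex.exp (-κ * x) * ((∫ y, growKer κ 0 y * h y ∂halfLine) +
        ∫ t in (0 : ℝ)..x, Complex.exp (-(-κ * t)) * 0) := by
    intro x hx
    simp only [mul_zero, intervalIntegral.integral_zero, add_zero]
    rw [← integral_const_mul]
    refine integral_congr_ae ?_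
    filter_upwards [ae_restrict_mem measurableSet_Ioi] with y hy
    have hy : 0 < y := hy
    simp only [reflKer, growKer, hy, if_true, Complex.ofReal_exp, abs_of_nonneg hx, abs_of_pos hy]
    have : Complex.exp ((-(κ * (x + y)) : ℝ) : ℂ) =
        Complex.exp (-κ * x) * Complex.exp ((-(κ * (y - 0)) : ℝ) : ℂ) := by
      rw [← Complex.exp_add]; push_cast; ring_nf
    rw [this]; ring
  refine ⟨?_, by rw [key 0 le_rfl]; simp [hh]⟩
  refine (IsACWithDeriv.exp_mul_primitive (h := fun _ => 0) (-κ)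
    (∫ y, growKer κ 0 y * h y ∂halfLine)
    (fun _ _ => intervalIntegrable_const)).congr (fun x hx => key x hx) ?_
  filter_upwards [ae_restrict_mem measurableSet_Ioi] with x hx
  rw [key x (le_of_lt hx), add_zero]

variable {w : ℝ → ℝ} (hw : IsWeight w) (hκ : 1 ≤ κ) (f : L2)

include hw hκ

theorem integrable_exp_neg_mul :
    Integrable (fun y : ℝ => Complex.exp (-(κ * y)) * (sqrtWeight w y * f y)) halfLine := by
  refine (integrable_kernel_mul hw (isExpKernel_growKer hκ) f 0).neg.congr ?_
  filter_upwards [ae_restrict_mem measurableSet_Ioi] with y hy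
  simp [growKer, mem_Ioi.1 hy]

/-- On a bounded interval the factor `exp(-κy)` of `integrable_exp_neg_mul` can be divided out. -/
theorem intervalIntegrable_sqrtWeight_mul (b : ℝ) (hb : 0 ≤ b) :
    IntervalIntegrable (fun y => sqrtWeight w y * f y) volume 0 b := by
  have h1 : IntervalIntegrable (fun y : ℝ => Complex.exp (-(κ * y)) * (sqrtWeight w y * f y))
      volume 0 b :=
    (intervalIntegrable_iff_integrableOn_Ioc_of_le hb).2
      (IntegrableOn.mono_set (integrable_exp_neg_mul hw hκ f) Ioc_subset_Ioi_self)
  have h2 := h1.continuousOn_mul (g := fun y : ℝ => Complex.exp (κ * y))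
    (Continuous.continuousOn (by fun_prop))
  refine h2.congr fun y _ => ?_
  rw [← mul_assoc, ← Complex.exp_add]
  simp

/-- Variation of constants with `-∫₀^∞ exp(-κt)h(t) dt` as the constant: it cancels the growing
exponential and leaves an integral over `(x, ∞)`. -/
theorem growKer_isAC :
    IsACWithDeriv (fun x => ∫ y, growKer κ x y * (sqrtWeight w y * f y) ∂halfLine)
      (fun x => κ * (∫ y, growKer κ x y * (sqrtWeight w y * f y) ∂halfLine)
        + sqrtWeight w x * f x) := by
  set h : ℝ → ℂ := fun y => sqrtWeight w y * f y with hh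
  set H : ℝ → ℂ := fun y => Complex.exp (-(κ * y)) * h y with hH
  have hHi : Integrable H halfLine := integrable_exp_neg_mul hw hκ f
  have key : ∀ x, 0 ≤ x → ∫ y, growKer κ x y * h y ∂halfLine =
      Complex.exp (κ * x) * (-(∫ t, H t ∂halfLine) + ∫ t in (0 : ℝ)..x, H t) := by
    intro x hx
    have e1 : ∫ y, growKer κ x y * h y ∂halfLine =
        ∫ y, -Complex.exp (κ * x) * (Ioi x).indicator H y ∂halfLine := by
      refine integral_congr_ae (ae_of_all _ fun y => ?_)
      by_cases hy : x < y
      · simp only [growKer, hy, if_true, indicator, mem_Ioi, hH, Complex.ofReal_exp]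
        have : Complex.exp ((-(κ * (y - x)) : ℝ) : ℂ) =
            Complex.exp (κ * x) * Complex.exp (-(κ * y)) := by
          rw [← Complex.exp_add]; push_cast; ring_nf
        rw [this]; ring
      · simp [growKer, hy]
    have e2 : ∫ t, H t ∂halfLine = (∫ t in (0 : ℝ)..x, H t) + ∫ t in Ioi x, H t := by
      rw [intervalIntegral.integral_of_le hx, ← setIntegral_union (Ioc_disjoint_Ioi le_rfl)
        measurableSet_Ioi (IntegrableOn.mono_set hHi Ioc_subset_Ioi_self)
        (IntegrableOn.mono_set hHi (Ioi_subset_Ioi hx)), Ioc_union_Ioi_eq_Ioi hx]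
    rw [e1, integral_const_mul, integral_indicator measurableSet_Ioi,
      Measure.restrict_restrict measurableSet_Ioi,
      inter_eq_left.2 (Ioi_subset_Ioi hx), e2]
    ring
  refine (IsACWithDeriv.exp_mul_primitive κ (-(∫ t, H t ∂halfLine))
    (intervalIntegrable_sqrtWeight_mul hw hκ f)).congr (fun x hx => key x hx) ?_
  filter_upwards [ae_restrict_mem measurableSet_Ioi] with x hx
  rw [key x (le_of_lt hx)]

theorem decayKer_isAC :
    IsACWithDeriv (fun x => ∫ y, decayKer κ x y * (sqrtWeight w y * f y) ∂halfLine)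
      (fun x => -κ * (∫ y, decayKer κ x y * (sqrtWeight w y * f y) ∂halfLine)
        + sqrtWeight w x * f x) ∧
    ∫ y, decayKer κ 0 y * (sqrtWeight w y * f y) ∂halfLine = 0 := by
  set h : ℝ → ℂ := fun y => sqrtWeight w y * f y with hh
  have key : ∀ x, 0 ≤ x → ∫ y, decayKer κ x y * h y ∂halfLine =
      Complex.exp (-κ * x) * (0 + ∫ t in (0 : ℝ)..x, Complex.exp (-(-κ * t)) * h t) := by
    intro x hx
    rw [zero_add, intervalIntegral.integral_of_le hx, integral_Ioc_eq_integral_Ioo,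
      ← integral_const_mul]
    have e1 : ∫ y, decayKer κ x y * h y ∂halfLine =
        ∫ y, (Iio x).indicator
          (fun y : ℝ => Complex.exp (-κ * x) * (Complex.exp (-(-κ * y)) * h y)) y ∂halfLine := by
      refine integral_congr_ae (ae_of_all _ fun y => ?_)
      by_cases hy : y < x
      · simp only [decayKer, hy, if_true, indicator, mem_Iio, Complex.ofReal_exp]
        have : Complex.exp ((-(κ * (x - y)) : ℝ) : ℂ) =
            Complex.exp (-κ * x) * Complex.exp (-(-κ * y)) := by
          rw [← Complex.exp_add]; push_cast; ring_nf
        rw [this]; ring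
      · simp [decayKer, hy]
    rw [e1, integral_indicator measurableSet_Iio, Measure.restrict_restrict measurableSet_Iio,
      inter_comm, Ioi_inter_Iio]
  refine ⟨?_, by rw [key 0 le_rfl]; simp⟩
  refine (IsACWithDeriv.exp_mul_primitive (-κ) 0
    (intervalIntegrable_sqrtWeight_mul hw hκ f)).congr (fun x hx => key x hx) ?_
  filter_upwards [ae_restrict_mem measurableSet_Ioi] with x hx
  rw [key x (le_of_lt hx)]

end Kernels

/-- The operator on `L² ⊕ L²` with the matrix `[[a, b], [c, d]]`. -/
def blockOp (a b c d : L2 →L[ℂ] L2) : L2 × L2 →L[ℂ] L2 × L2 :=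
  ContinuousLinearMap.inl ℂ L2 L2 ∘L
      (a ∘L ContinuousLinearMap.fst ℂ L2 L2 + b ∘L ContinuousLinearMap.snd ℂ L2 L2) +
    ContinuousLinearMap.inr ℂ L2 L2 ∘L
      (c ∘L ContinuousLinearMap.fst ℂ L2 L2 + d ∘L ContinuousLinearMap.snd ℂ L2 L2)

theorem blockOp_apply (a b c d : L2 →L[ℂ] L2) (x : L2 × L2) :
    blockOp a b c d x = (a x.1 + b x.2, c x.1 + d x.2) := by
  simp [blockOp]

/-- The solution operator of the free system in weighted variables, with the boundary condition
`(1 - r) u(0) = (1 + r) p(0)`. -/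
def greenOp (A B C : L2 →L[ℂ] L2) (r : ℂ) : L2 × L2 →L[ℂ] L2 × L2 :=
  blockOp ((2 : ℂ)⁻¹ • (A + B + r • C)) ((2 : ℂ)⁻¹ • (A - B + r • C))
    ((2 : ℂ)⁻¹ • (A - B - r • C)) ((2 : ℂ)⁻¹ • (A + B - r • C))

theorem coeFn_lincomb {A B C : L2} {a b c : ℝ → ℂ} {w : ℝ → ℝ} (s t : ℂ)
    (hA : A =ᵐ[halfLine] fun x => sqrtWeight w x * a x)
    (hB : B =ᵐ[halfLine] fun x => sqrtWeight w x * b x)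
    (hC : C =ᵐ[halfLine] fun x => sqrtWeight w x * c x) :
    ((2 : ℂ)⁻¹ • (A + s • B + t • C) : L2) =ᵐ[halfLine]
      fun x => sqrtWeight w x * ((2 : ℂ)⁻¹ * (a x + (s * b x + t * c x))) := by
  filter_upwards [hA, hB, hC, Lp.coeFn_smul (2 : ℂ)⁻¹ (A + s • B + t • C),
    Lp.coeFn_add (A + s • B) (t • C), Lp.coeFn_add A (s • B), Lp.coeFn_smul s B,
    Lp.coeFn_smul t C] with x h1 h2 h3 h4 h5 h6 h7 h8
  rw [h4, Pi.smul_apply, h5, Pi.add_apply, h6, Pi.add_apply, h7, h8, Pi.smul_apply, Pi.smul_apply,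
    h1, h2, h3]
  simp only [smul_eq_mul]
  ring

/-- The combinations `u + p` and `u - p` decouple, with rates `κ` and `-κ` and sources `f₁ ± f₂`;
this gives `a` and `b`. The reflected wave `r c` may be added to `u - p`, being a decaying
homogeneous solution. Since `b(0) = 0` and `c(0) = a(0)`, the boundary values are those stated with
`ξ = a(0)/2`. -/
theorem greenOp_spec {κ : ℝ} {w : ℝ → ℝ} (hw : IsWeight w) (hκ : 1 ≤ κ) {A B C : L2 →L[ℂ] L2}
    (hA : ∀ f : L2, A f =ᵐ[halfLine] fun x =>
      (sqrtWeight w x : ℂ) * ∫ y, growKer κ x y * (sqrtWeight w y * f y) ∂halfLine)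
    (hB : ∀ f : L2, B f =ᵐ[halfLine] fun x =>
      (sqrtWeight w x : ℂ) * ∫ y, decayKer κ x y * (sqrtWeight w y * f y) ∂halfLine)
    (hC : ∀ f : L2, C f =ᵐ[halfLine] fun x =>
      (sqrtWeight w x : ℂ) * ∫ y, reflKer κ x y * (sqrtWeight w y * f y) ∂halfLine)
    (r : ℂ) (f : L2 × L2) :
    ∃ u p : ℝ → ℂ, ∃ ξ : ℂ,
      IsACWithDeriv u (fun x => κ * p x + sqrtWeight w x * f.1 x) ∧
      IsACWithDeriv p (fun x => κ * u x + sqrtWeight w x * f.2 x) ∧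
      (greenOp A B C r f).1 =ᵐ[halfLine] (fun x => sqrtWeight w x * u x) ∧
      (greenOp A B C r f).2 =ᵐ[halfLine] (fun x => sqrtWeight w x * p x) ∧
      u 0 = (1 + r) * ξ ∧ p 0 = (1 - r) * ξ := by
  have ha := growKer_isAC hw hκ (f.1 + f.2)
  obtain ⟨hb, hb0⟩ := decayKer_isAC hw hκ (f.1 - f.2)
  obtain ⟨hc, hc0⟩ := reflKer_isAC κ w (f.1 + f.2)
  have kA := hA (f.1 + f.2)
  have kB := hB (f.1 - f.2)
  have kC := hC (f.1 + f.2)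
  set a : ℝ → ℂ := fun x => ∫ y, growKer κ x y * (sqrtWeight w y * (f.1 + f.2 : L2) y) ∂halfLine
  set b : ℝ → ℂ := fun x => ∫ y, decayKer κ x y * (sqrtWeight w y * (f.1 - f.2 : L2) y) ∂halfLine
  set c : ℝ → ℂ := fun x => ∫ y, reflKer κ x y * (sqrtWeight w y * (f.1 + f.2 : L2) y) ∂halfLine
  refine ⟨fun x => (2 : ℂ)⁻¹ * (a x + (1 * b x + r * c x)),
    fun x => (2 : ℂ)⁻¹ * (a x + ((-1) * b x + (-r) * c x)), (2 : ℂ)⁻¹ * a 0, ?_, ?_, ?_, ?_, ?_, ?_⟩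
  · refine ((ha.add ((hb.const_mul 1).add (hc.const_mul r))).const_mul (2 : ℂ)⁻¹).congr
      (fun _ _ => rfl) ?_
    filter_upwards [Lp.coeFn_add f.1 f.2, Lp.coeFn_sub f.1 f.2] with x h1 h2
    simp only [h1, h2, Pi.add_apply, Pi.sub_apply]
    ring
  · refine ((ha.add ((hb.const_mul (-1)).add (hc.const_mul (-r)))).const_mul (2 : ℂ)⁻¹).congr
      (fun _ _ => rfl) ?_
    filter_upwards [Lp.coeFn_add f.1 f.2, Lp.coeFn_sub f.1 f.2] with x h1 h2
    simp only [h1, h2, Pi.add_apply, Pi.sub_apply]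
    ring
  · have e : (greenOp A B C r f).1 =
        (2 : ℂ)⁻¹ • (A (f.1 + f.2) + (1 : ℂ) • B (f.1 - f.2) + (r) • C (f.1 + f.2)) := by
      simp only [greenOp, blockOp_apply, smul_apply,
        add_apply, sub_apply, map_add, map_sub]
      module
    rw [e]
    exact coeFn_lincomb _ _ kA kB kC
  · have e : (greenOp A B C r f).2 =
        (2 : ℂ)⁻¹ • (A (f.1 + f.2) + (-1 : ℂ) • B (f.1 - f.2) + (-r) • C (f.1 + f.2)) := by
      simp only [greenOp, blockOp_apply, smul_apply,
        add_apply, sub_apply, map_add, map_sub]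
      module
    rw [e]
    exact coeFn_lincomb _ _ kA kB kC
  · have h1 : b 0 = 0 := hb0
    have h2 : c 0 = a 0 := hc0
    simp only [h1, h2]; ring
  · have h1 : b 0 = 0 := hb0
    have h2 : c 0 = a 0 := hc0
    simp only [h1, h2]; ring

/-! ### The perturbed first-order system -/

/-- Integral and multiplication operators, in weighted variables, from which the resolvents of the
Dirac and the Schrödinger operator are built. -/
structure SystemData (κ : ℝ) (V : ℝ → Matrix (Fin 2) (Fin 2) ℂ) (w : ℝ → ℝ) where
  one_le : 1 ≤ κ
  isWeight : IsWeight w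
  (A B C : L2 →L[ℂ] L2)
  A_spec : ∀ f : L2, A f =ᵐ[halfLine] fun x =>
    (sqrtWeight w x : ℂ) * ∫ y, growKer κ x y * (sqrtWeight w y * f y) ∂halfLine
  B_spec : ∀ f : L2, B f =ᵐ[halfLine] fun x =>
    (sqrtWeight w x : ℂ) * ∫ y, decayKer κ x y * (sqrtWeight w y * f y) ∂halfLine
  C_spec : ∀ f : L2, C f =ᵐ[halfLine] fun x =>
    (sqrtWeight w x : ℂ) * ∫ y, reflKer κ x y * (sqrtWeight w y * f y) ∂halfLine
  A_norm : ‖A‖ ≤ (schurConst w).toReal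
  B_norm : ‖B‖ ≤ (schurConst w).toReal
  C_norm : ‖C‖ ≤ (schurConst w).toReal
  N : L2 →L[ℂ] L2
  N_spec : ∀ f : L2, N f =ᵐ[halfLine] fun x => (sqrtWeight w x : ℂ)⁻¹ * f x
  M : Fin 2 → Fin 2 → L2 →L[ℂ] L2
  M_spec : ∀ i j, ∀ f : L2, M i j f =ᵐ[halfLine] fun x =>
    (V x i j * ((sqrtWeight w x : ℂ) ^ 2)⁻¹) * f x
  M_norm : ∀ i j, ‖M i j‖ ≤ 1

theorem nonempty_systemData {κ : ℝ} (hκ : 1 ≤ κ) {V : ℝ → Matrix (Fin 2) (Fin 2) ℂ} {w : ℝ → ℝ}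
    (hw : IsWeight w) (hV : ∀ i j, AEStronglyMeasurable (fun x => V x i j) halfLine)
    (hVw : ∀ i j, ∀ᵐ x ∂halfLine, ‖V x i j‖ ≤ w x) : Nonempty (SystemData κ V w) := by
  obtain ⟨A, hA, hA'⟩ := exists_kernelOp hw (isExpKernel_growKer hκ)
  obtain ⟨B, hB, hB'⟩ := exists_kernelOp hw (isExpKernel_decayKer hκ)
  obtain ⟨C, hC, hC'⟩ := exists_kernelOp hw (isExpKernel_reflKer hκ)
  have hm : Measurable fun y => (sqrtWeight w y : ℂ) :=
    Complex.measurable_ofReal.comp hw.measurable_sqrtWeight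
  have hN : ∃ N : L2 →L[ℂ] L2, ‖N‖ ≤ 1 ∧
      ∀ f : L2, N f =ᵐ[halfLine] fun x => (sqrtWeight w x : ℂ)⁻¹ * f x := by
    refine exists_mulOp hm.inv.aestronglyMeasurable zero_le_one (ae_of_all _ fun x => ?_)
    rw [norm_inv, Complex.norm_real, Real.norm_of_nonneg (sqrtWeight_nonneg w x)]
    exact inv_le_one_of_one_le₀ (hw.one_le_sqrtWeight x)
  have hM : ∀ i j, ∃ M : L2 →L[ℂ] L2, ‖M‖ ≤ 1 ∧
      ∀ f : L2, M f =ᵐ[halfLine] fun x => (V x i j * ((sqrtWeight w x : ℂ) ^ 2)⁻¹) * f x := by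
    intro i j
    refine exists_mulOp ((hV i j).mul (hm.pow_const 2).inv.aestronglyMeasurable) zero_le_one ?_
    filter_upwards [hVw i j] with x hx
    rw [norm_mul, norm_inv, norm_pow, Complex.norm_real,
      Real.norm_of_nonneg (sqrtWeight_nonneg w x), hw.sq_sqrtWeight, ← div_eq_mul_inv]
    exact div_le_one_of_le₀ (by linarith) (by linarith [hw.nonneg x])
  obtain ⟨N, -, hN'⟩ := hN
  choose M hM hM' using hM
  exact ⟨⟨hκ, hw, A, B, C, hA', hB', hC', hA, hB, hC, N, hN', M, hM', hM⟩⟩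

/-- Measurable representatives of the entries are summed, because a weight has to be measurable
everywhere. -/
theorem exists_weight {V : ℝ → Matrix (Fin 2) (Fin 2) ℂ}
    (hV : ∀ i j, Integrable (fun x => V x i j) halfLine) :
    ∃ w, IsWeight w ∧ ∀ i j, ∀ᵐ x ∂halfLine, ‖V x i j‖ ≤ w x := by
  refine ⟨fun x => ∑ i, ∑ j, ‖(hV i j).1.mk _ x‖, ⟨?_, fun x => ?_, ?_⟩, fun i j => ?_⟩
  · exact Finset.measurable_sum _ fun i _ => Finset.measurable_sum _ fun j _ =>
      (hV i j).1.stronglyMeasurable_mk.norm.measurable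
  · exact Finset.sum_nonneg fun i _ => Finset.sum_nonneg fun j _ => norm_nonneg _
  · exact integrable_finsetSum _ fun i _ => integrable_finsetSum _ fun j _ =>
      ((hV i j).congr (hV i j).1.ae_eq_mk).norm
  · filter_upwards [(hV i j).1.ae_eq_mk] with x hx
    rw [hx]
    calc _ ≤ ∑ j, ‖(hV i j).1.mk _ x‖ :=
          Finset.single_le_sum (f := fun j => ‖(hV i j).1.mk _ x‖)
            (fun _ _ => norm_nonneg _) (Finset.mem_univ j)
      _ ≤ _ := Finset.single_le_sum (f := fun i => ∑ j, ‖(hV i j).1.mk _ x‖)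
            (fun _ _ => Finset.sum_nonneg fun j _ => norm_nonneg _) (Finset.mem_univ i)

namespace SystemData

variable {κ : ℝ} {V : ℝ → Matrix (Fin 2) (Fin 2) ℂ} {w : ℝ → ℝ} (D : SystemData κ V w) (m : ℝ)

/-- The solution operator of the free system. -/
def green (r : ℂ) : L2 × L2 →L[ℂ] L2 × L2 := greenOp D.A D.B D.C r

/-- The point at which resolvents are constructed. -/
def basePoint (κ m : ℝ) : ℂ := κ ^ 2 / (2 * m)

/-- The perturbation; `ε` is the inverse of the speed of light. -/
def pert (ε : ℂ) : L2 × L2 →L[ℂ] L2 × L2 :=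
  blockOp (ε • D.M 0 1) ((ε ^ 2 * (κ / (2 * m))) • (D.M 0 0 - basePoint κ m • (D.N * D.N)))
    (-(2 * m / κ : ℂ) • D.M 1 1) (-ε • D.M 1 0)

/-- The source term. -/
def source (ε : ℂ) : L2 × L2 →L[ℂ] L2 × L2 :=
  blockOp (-ε • D.N) 0 0 ((2 * m / κ : ℂ) • D.N)

/-- The map from the solution of the first-order system to spinors. -/
def out (ε : ℂ) : L2 × L2 →L[ℂ] L2 × L2 :=
  blockOp 0 ((ε * (κ / (2 * m))) • D.N) D.N 0

/-- The resolvent of the Dirac operator (and of the Schrödinger operator if `ε = 0`). -/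
def sol (ε r : ℂ) : L2 × L2 →L[ℂ] L2 × L2 :=
  D.out m ε * (Ring.inverse (1 - D.green r * D.pert m ε) * (D.green r * D.source m ε))

/-- The weighted unknown `v = (√(1+w) u, √(1+w) p)` is the fixed point of `v = green (pert v +
source f)`. The element `P` records that `p` is square integrable, which for `ε = 0` means that `u'`
is; the Schrödinger injectivity argument needs this. -/
theorem exists_solution {ε r : ℂ} (hu : IsUnit (1 - D.green r * D.pert m ε)) (f : L2 × L2) :
    ∃ u p : ℝ → ℂ, ∃ ξ : ℂ, ∃ P : L2,
      IsACWithDeriv u (fun x => κ * p x + (ε * (V x 0 1 * u x) +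
        ε ^ 2 * (κ / (2 * m)) * ((V x 0 0 - basePoint κ m) * p x) - ε * f.1 x)) ∧
      IsACWithDeriv p (fun x => κ * u x + (-(2 * m / κ) * (V x 1 1 * u x) -
        ε * (V x 1 0 * p x) + 2 * m / κ * f.2 x)) ∧
      (D.sol m ε r f).1 =ᵐ[halfLine] (fun x => ε * (κ / (2 * m)) * p x) ∧
      (D.sol m ε r f).2 =ᵐ[halfLine] u ∧ P =ᵐ[halfLine] p ∧
      u 0 = (1 + r) * ξ ∧ p 0 = (1 - r) * ξ := by
  set v : L2 × L2 := Ring.inverse (1 - D.green r * D.pert m ε) (D.green r (D.source m ε f)) with hv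
  have hfix : D.green r (D.pert m ε v + D.source m ε f) = v := by
    have h1 := congrArg (fun L : L2 × L2 →L[ℂ] L2 × L2 => L (D.green r (D.source m ε f)))
      (Ring.mul_inverse_cancel _ hu)
    have h2 : v - D.green r (D.pert m ε v) = D.green r (D.source m ε f) := h1
    rw [map_add, ← h2]; abel
  obtain ⟨u, p, ξ, hau, hap, hv1, hv2, h0, h1⟩ := greenOp_spec D.isWeight D.one_le D.A_spec D.B_spec
    D.C_spec r (D.pert m ε v + D.source m ε f)
  change (D.green r _).1 =ᵐ[halfLine] _ at hv1
  change (D.green r _).2 =ᵐ[halfLine] _ at hv2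
  rw [hfix] at hv1 hv2
  have hω : ∀ x, (sqrtWeight w x : ℂ) ≠ 0 := fun x => by
    have := D.isWeight.one_le_sqrtWeight x
    exact_mod_cast (by linarith : (0 : ℝ) < sqrtWeight w x).ne'
  have hNp : D.N v.2 =ᵐ[halfLine] p := by
    filter_upwards [D.N_spec v.2, hv2] with x e1 e2
    rw [e1, e2, inv_mul_cancel_left₀ (hω x)]
  have hNu : D.N v.1 =ᵐ[halfLine] u := by
    filter_upwards [D.N_spec v.1, hv1] with x e1 e2
    rw [e1, e2, inv_mul_cancel_left₀ (hω x)]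
  refine ⟨u, p, ξ, D.N v.2, hau.congr (fun _ _ => rfl) ?_, hap.congr (fun _ _ => rfl) ?_, ?_, ?_,
    hNp, h0, h1⟩
  · have e : (D.pert m ε v + D.source m ε f).1 = ε • D.M 0 1 v.1 +
        ((ε ^ 2 * (κ / (2 * m))) • (D.M 0 0 v.2 + (-basePoint κ m) • D.N (D.N v.2)) +
          (-ε) • D.N f.1) := by
      simp only [pert, source, blockOp_apply, smul_apply, sub_apply, Prod.fst_add, zero_apply,
        mul_apply_eq_comp]
      module
    rw [e]
    filter_upwards [Lp.coeFn_add (ε • D.M 0 1 v.1)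
        ((ε ^ 2 * (κ / (2 * m))) • (D.M 0 0 v.2 + (-basePoint κ m) • D.N (D.N v.2)) +
          (-ε) • D.N f.1),
      Lp.coeFn_add ((ε ^ 2 * (κ / (2 * m))) • (D.M 0 0 v.2 + (-basePoint κ m) • D.N (D.N v.2)))
        ((-ε) • D.N f.1), Lp.coeFn_add (D.M 0 0 v.2) ((-basePoint κ m) • D.N (D.N v.2)),
      Lp.coeFn_smul ε (D.M 0 1 v.1), Lp.coeFn_smul (ε ^ 2 * (κ / (2 * m)))
        (D.M 0 0 v.2 + (-basePoint κ m) • D.N (D.N v.2)), Lp.coeFn_smul (-ε) (D.N f.1),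
      Lp.coeFn_smul (-basePoint κ m) (D.N (D.N v.2)), D.M_spec 0 1 v.1, D.M_spec 0 0 v.2,
      D.N_spec (D.N v.2), D.N_spec f.1, hNp, hv1, hv2]
      with x e1 e2 e3 e4 e5 e6 e7 e8 e9 e10 e11 e12 e13 e14
    simp only [e1, e2, e3, e4, e5, e6, e7, e8, e9, e10, e11, e12, e13, e14, Pi.add_apply,
      Pi.smul_apply, smul_eq_mul]
    have := hω x
    field_simp
    ring
  · have e : (D.pert m ε v + D.source m ε f).2 = (-(2 * m / κ : ℂ)) • D.M 1 1 v.1 +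
        ((-ε) • D.M 1 0 v.2 + (2 * m / κ : ℂ) • D.N f.2) := by
      simp only [pert, source, blockOp_apply, smul_apply, Prod.snd_add, zero_apply]
      module
    rw [e]
    filter_upwards [Lp.coeFn_add ((-(2 * m / κ : ℂ)) • D.M 1 1 v.1)
        ((-ε) • D.M 1 0 v.2 + (2 * m / κ : ℂ) • D.N f.2),
      Lp.coeFn_add ((-ε) • D.M 1 0 v.2) ((2 * m / κ : ℂ) • D.N f.2),
      Lp.coeFn_smul (-(2 * m / κ : ℂ)) (D.M 1 1 v.1), Lp.coeFn_smul (-ε) (D.M 1 0 v.2),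
      Lp.coeFn_smul (2 * m / κ : ℂ) (D.N f.2), D.M_spec 1 1 v.1, D.M_spec 1 0 v.2,
      D.N_spec f.2, hv1, hv2] with x e1 e2 e3 e4 e5 e6 e7 e8 e9 e10
    simp only [e1, e2, e3, e4, e5, e6, e7, e8, e9, e10, Pi.add_apply, Pi.smul_apply, smul_eq_mul]
    have h := hω x
    have a1 : (sqrtWeight w x : ℂ) * (sqrtWeight w x : ℂ)⁻¹ = 1 := mul_inv_cancel₀ h
    have a2 : (sqrtWeight w x : ℂ) ^ 2 * ((sqrtWeight w x : ℂ) ^ 2)⁻¹ = 1 :=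
      mul_inv_cancel₀ (pow_ne_zero 2 h)
    linear_combination (-(2 * m / κ : ℂ) * V x 1 1 * u x - ε * V x 1 0 * p x) * (-a2) -
      (2 * m / κ : ℂ) * f.2 x * a1
  · have e : (D.sol m ε r f).1 = (ε * (κ / (2 * m))) • D.N v.2 := by
      change (D.out m ε v).1 = _
      simp [out, blockOp_apply]
    rw [e]
    filter_upwards [Lp.coeFn_smul (ε * (κ / (2 * m))) (D.N v.2), hNp] with x e1 e2
    rw [e1, Pi.smul_apply, e2, smul_eq_mul]
  · have e : (D.sol m ε r f).2 = D.N v.1 := by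
      change (D.out m ε v).2 = _
      simp [out, blockOp_apply]
    rw [e]
    exact hNu

/-- At `ε = 0` only the entry `-(2m/κ)V₂₂` survives, while the bound on `A`, `B`, `C` does not
involve `κ`. -/
theorem norm_green_pert_zero_lt {m : ℝ} (hm : 0 < m) {r : ℂ} (hr : ‖r‖ ≤ 1)
    (hκ : 6 * m * (schurConst w).toReal < κ) : ‖D.green r * D.pert m 0‖ < 1 := by
  set K := (schurConst w).toReal with hK
  have hκ0 : 0 < κ := zero_lt_one.trans_le D.one_le
  have hK0 : 0 ≤ K := ENNReal.toReal_nonneg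
  -- Three operators of norm at most `K`, times `2m/κ`; the factor `1/2` in `greenOp` is given away.
  refine lt_of_le_of_lt (b := 6 * m * K / κ) ?_ ((div_lt_one hκ0).2 hκ)
  refine ContinuousLinearMap.opNorm_le_bound _ (by positivity) fun x => ?_
  set g : L2 := (-(2 * m / κ : ℂ)) • D.M 1 1 x.1 with hg
  have hgn : ‖g‖ ≤ 2 * m / κ * ‖x‖ := by
    rw [hg, norm_smul, norm_neg]
    have e1 : ‖(2 * m / κ : ℂ)‖ = 2 * m / κ := by
      have : (2 * m / κ : ℂ) = ((2 * m / κ : ℝ) : ℂ) := by push_cast; rfl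
      rw [this, Complex.norm_real, Real.norm_of_nonneg (by positivity)]
    rw [e1]
    gcongr
    calc _ ≤ ‖D.M 1 1‖ * ‖x.1‖ := ContinuousLinearMap.le_opNorm _ _
      _ ≤ 1 * ‖x‖ := by gcongr; exacts [D.M_norm 1 1, norm_fst_le x]
      _ = _ := one_mul _
  have e : (D.green r * D.pert m 0) x = ((2 : ℂ)⁻¹ • (D.A g - D.B g + r • D.C g),
      (2 : ℂ)⁻¹ • (D.A g + D.B g - r • D.C g)) := by
    have : D.pert m 0 x = (0, g) := by
      simp [pert, blockOp_apply, hg]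
    rw [mul_apply_eq_comp, this, green, greenOp, blockOp_apply]
    simp
  have hA : ‖D.A g‖ ≤ K * ‖g‖ := D.A.le_of_opNorm_le D.A_norm g
  have hB : ‖D.B g‖ ≤ K * ‖g‖ := D.B.le_of_opNorm_le D.B_norm g
  have hC : ‖r • D.C g‖ ≤ K * ‖g‖ := by
    rw [norm_smul]
    calc _ ≤ 1 * ‖D.C g‖ := by gcongr
      _ ≤ _ := by rw [one_mul]; exact D.C.le_of_opNorm_le D.C_norm g
  have h2 : ‖(2 : ℂ)⁻¹‖ ≤ 1 := by norm_num
  have hfin : 3 * (K * ‖g‖) ≤ 6 * m * K / κ * ‖x‖ := by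
    calc 3 * (K * ‖g‖) ≤ 3 * (K * (2 * m / κ * ‖x‖)) := by gcongr
      _ = _ := by ring
  rw [e, Prod.norm_def]
  refine max_le ?_ ?_ <;> refine le_trans ?_ hfin <;> rw [norm_smul]
  · have h3 := norm_add_le (D.A g - D.B g) (r • D.C g)
    have h4 := norm_sub_le (D.A g) (D.B g)
    nlinarith [norm_nonneg (D.A g - D.B g + r • D.C g)]
  · have h3 := norm_sub_le (D.A g + D.B g) (r • D.C g)
    have h4 := norm_add_le (D.A g) (D.B g)
    nlinarith [norm_nonneg (D.A g + D.B g - r • D.C g)]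

theorem isUnit_zero {m : ℝ} (hm : 0 < m) {r : ℂ} (hr : ‖r‖ ≤ 1)
    (hκ : 6 * m * (schurConst w).toReal < κ) : IsUnit (1 - D.green r * D.pert m 0) :=
  isUnit_one_sub_of_norm_lt_one (D.norm_green_pert_zero_lt hm hr hκ)

theorem continuous_green : Continuous D.green := by
  unfold green greenOp blockOp
  fun_prop

theorem continuous_pert : Continuous (D.pert m) := by
  unfold pert blockOp
  fun_prop

theorem continuous_source : Continuous (D.source m) := by
  unfold source blockOp
  fun_prop

theorem continuous_out : Continuous (D.out m) := by
  unfold out blockOp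
  fun_prop

variable {m} {l : Filter ℝ} {ε r : ℝ → ℂ} {r₀ : ℂ}

theorem tendsto_one_sub (hε : Tendsto ε l (𝓝 0)) (hr : Tendsto r l (𝓝 r₀)) :
    Tendsto (fun c => 1 - D.green (r c) * D.pert m (ε c)) l (𝓝 (1 - D.green r₀ * D.pert m 0)) :=
  tendsto_const_nhds.sub (((D.continuous_green.tendsto r₀).comp hr).mul
    (((D.continuous_pert m).tendsto 0).comp hε))

theorem eventually_isUnit (hu : IsUnit (1 - D.green r₀ * D.pert m 0)) (hε : Tendsto ε l (𝓝 0))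
    (hr : Tendsto r l (𝓝 r₀)) : ∀ᶠ c in l, IsUnit (1 - D.green (r c) * D.pert m (ε c)) :=
  (D.tendsto_one_sub hε hr).eventually (Units.isOpen.mem_nhds hu)

theorem tendsto_sol (hu : IsUnit (1 - D.green r₀ * D.pert m 0)) (hε : Tendsto ε l (𝓝 0))
    (hr : Tendsto r l (𝓝 r₀)) : Tendsto (fun c => D.sol m (ε c) (r c)) l (𝓝 (D.sol m 0 r₀)) := by
  obtain ⟨U, hU⟩ := hu
  have h1 := D.tendsto_one_sub (m := m) hε hr
  rw [← hU] at h1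
  have h2 := (NormedRing.inverse_continuousAt U).tendsto.comp h1
  rw [hU] at h2
  exact (((D.continuous_out m).tendsto 0).comp hε).mul (h2.mul
    (((D.continuous_green.tendsto r₀).comp hr).mul (((D.continuous_source m).tendsto 0).comp hε)))

end SystemData

/-! ### Injectivity from the Lagrange identity -/

theorem integrable_mul_L2 (f g : L2) : Integrable (fun x => f x * g x) halfLine :=
  (Lp.memLp f).integrable_mul (Lp.memLp g)

theorem eq_zero_of_integral_mul {f : L2} (h : ∀ g : L2, ∫ x, f x * g x ∂halfLine = 0) : f = 0 := by
  have h1 := h (star f)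
  rw [← inner_self_eq_zero (𝕜 := ℂ), L2.inner_def, ← h1]
  refine integral_congr_ae ?_
  filter_upwards [Lp.coeFn_star f] with x hx
  rw [hx, Pi.star_apply]
  rfl

/-- The pairing is bilinear, without conjugation, so the adjoint problem has the transposed
potential and the same `z`. The Wronskian of `ψ` and `χ` has derivative `-(ψ·h)/c`. It vanishes at 0
by the boundary conditions and at infinity because it and its derivative are integrable; so `∫ ψ·h =
0` for all `h`. -/
theorem dirac_injective {m c α : ℝ} (hc : c ≠ 0) {V : ℝ → Matrix (Fin 2) (Fin 2) ℂ} {z : ℂ}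
    (hsurj : ∀ h : Spinor, ∃ χ : Spinor,
      (χ, h + z • χ) ∈ diracGraph m c α (fun x => (V x).transpose))
    {ψ : Spinor} (hψ : (ψ, z • ψ) ∈ diracGraph m c α V) : ψ = 0 := by
  obtain ⟨u₁, u₂, g₁, g₂, hu₁, hu₂, e1, e2, hbc, d1, d2⟩ := hψ
  have key : ∀ h : Spinor, ∫ x, (ψ.fst x * h.fst x + ψ.snd x * h.snd x) ∂halfLine = 0 := by
    intro h
    obtain ⟨χ, v₁, v₂, k₁, k₂, hv₁, hv₂, e1', e2', hbc', d1', d2'⟩ := hsurj h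
    have hW := (hu₁.mul hv₂).sub (hu₂.mul hv₁)
    have hW' := hW.congr (h := fun x => (-(c : ℂ)⁻¹) * (ψ.fst x * h.fst x + ψ.snd x * h.snd x))
      (fun _ _ => rfl) (by
        have hc' : (c : ℂ) ≠ 0 := by exact_mod_cast hc
        filter_upwards [e1, e2, e1', e2', d1, d2, d1', d2', Lp.coeFn_smul z ψ.fst,
          Lp.coeFn_smul z ψ.snd, Lp.coeFn_add h.fst (z • χ.fst), Lp.coeFn_smul z χ.fst,
          Lp.coeFn_add h.snd (z • χ.snd), Lp.coeFn_smul z χ.snd]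
          with x a1 a2 a3 a4 b1 b2 b3 b4 s1 s2 s3 s4 s5 s6
        have t1 : z * u₁ x = (m * c ^ 2 : ℂ) * u₁ x - c * g₂ x +
            (V x 0 0 * u₁ x + V x 0 1 * u₂ x) := (congrArg (z * ·) a1.symm).trans (s1.symm.trans b1)
        have t2 : z * u₂ x = c * g₁ x - (m * c ^ 2 : ℂ) * u₂ x +
            (V x 1 0 * u₁ x + V x 1 1 * u₂ x) := (congrArg (z * ·) a2.symm).trans (s2.symm.trans b2)
        have t3 : h.fst x + z * v₁ x = (m * c ^ 2 : ℂ) * v₁ x - c * k₂ x +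
            (V x 0 0 * v₁ x + V x 1 0 * v₂ x) := by
          refine (congrArg (h.fst x + z * ·) a3.symm).trans (Eq.trans ?_ (s3.symm.trans b3))
          rw [Pi.add_apply, s4]; rfl
        have t4 : h.snd x + z * v₂ x = c * k₁ x - (m * c ^ 2 : ℂ) * v₂ x +
            (V x 0 1 * v₁ x + V x 1 1 * v₂ x) := by
          refine (congrArg (h.snd x + z * ·) a4.symm).trans (Eq.trans ?_ (s5.symm.trans b4))
          rw [Pi.add_apply, s6]; rfl
        rw [a1, a2]
        have : u₁ x * h.fst x + u₂ x * h.snd x = -(c : ℂ) * ((g₁ x * v₂ x + k₂ x * u₁ x) -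
            (g₂ x * v₁ x + k₁ x * u₂ x)) := by
          linear_combination u₁ x * t3 + u₂ x * t4 - v₁ x * t1 - v₂ x * t2
        rw [this]
        field_simp)
    have hWi : Integrable (fun x => u₁ x * v₂ x - u₂ x * v₁ x) halfLine := by
      refine ((integrable_mul_L2 ψ.fst χ.snd).sub (integrable_mul_L2 ψ.snd χ.fst)).congr ?_
      filter_upwards [e1, e2, e1', e2'] with x a1 a2 a3 a4
      change ψ.fst x * χ.snd x - ψ.snd x * χ.fst x = _
      have a1 : ψ.fst x = u₁ x := a1
      have a2 : ψ.snd x = u₂ x := a2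
      have a3 : χ.fst x = v₁ x := a3
      have a4 : χ.snd x = v₂ x := a4
      rw [a1, a2, a3, a4]
    have hWd : Integrable (fun x => (-(c : ℂ)⁻¹) *
        (ψ.fst x * h.fst x + ψ.snd x * h.snd x)) halfLine :=
      ((integrable_mul_L2 ψ.fst h.fst).add (integrable_mul_L2 ψ.snd h.snd)).const_mul _
    -- Both boundary vectors are annihilated by the nonzero covector `(cos α, -sin α)`, so they are
    -- parallel.
    have h0 : u₁ 0 * v₂ 0 - u₂ 0 * v₁ 0 = 0 := by
      have hcs : (Real.cos α : ℂ) ^ 2 + (Real.sin α : ℂ) ^ 2 = 1 := by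
        exact_mod_cast Real.cos_sq_add_sin_sq α
      linear_combination (-(u₁ 0 * v₂ 0 - u₂ 0 * v₁ 0)) * hcs +
        (Real.cos α * v₂ 0 + Real.sin α * v₁ 0) * hbc -
        (Real.cos α * u₂ 0 + Real.sin α * u₁ 0) * hbc'
    have hfin := hW'.integral_deriv_eq hWi hWd
    rw [integral_const_mul, h0, neg_zero, mul_eq_zero] at hfin
    exact hfin.resolve_left (neg_ne_zero.2 (inv_ne_zero (by exact_mod_cast hc)))
  have z0 : ((0 : L2) : ℝ → ℂ) =ᵐ[halfLine] fun _ => 0 := Lp.coeFn_zero ℂ 2 halfLine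
  refine Spinor.ext (eq_zero_of_integral_mul fun g => ?_) (eq_zero_of_integral_mul fun g => ?_)
  · rw [← key (WithLp.toLp 2 (g, 0))]
    refine integral_congr_ae ?_
    filter_upwards [z0] with x hx
    change ψ.fst x * g x = ψ.fst x * g x + ψ.snd x * (0 : L2) x
    rw [hx]; ring
  · rw [← key (WithLp.toLp 2 (0, g))]
    refine integral_congr_ae ?_
    filter_upwards [z0] with x hx
    change ψ.snd x * g x = ψ.fst x * (0 : L2) x + ψ.snd x * g x
    rw [hx]; ring

theorem tendsto_integral_window {W : ℝ → ℂ} {l : ℂ} (hW : ContinuousOn W (Ici 0))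
    (hl : Tendsto W atTop (𝓝 l)) : Tendsto (fun x => ∫ t in x..x + 1, W t) atTop (𝓝 l) := by
  rw [Metric.tendsto_atTop] at hl ⊢
  intro ε hε
  obtain ⟨R, hR⟩ := hl (ε / 2) (half_pos hε)
  refine ⟨max R 0, fun x hx => ?_⟩
  have hi : IntervalIntegrable W volume x (x + 1) := by
    refine ContinuousOn.intervalIntegrable (hW.mono ?_)
    rw [uIcc_of_le (by linarith)]
    exact fun t ht => (le_max_right R 0).trans (hx.trans ht.1)
  have e : (∫ t in x..x + 1, W t) - l = ∫ t in x..x + 1, (W t - l) := by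
    rw [intervalIntegral.integral_sub hi intervalIntegrable_const]
    simp
  rw [dist_eq_norm, e]
  refine lt_of_le_of_lt (intervalIntegral.norm_integral_le_of_norm_le_const (C := ε / 2)
    fun t ht => ?_) (by simpa using hε)
  rw [uIoc_of_le (by linarith)] at ht
  rw [← dist_eq_norm]
  exact (hR t ((le_max_left R 0).trans (hx.trans ht.1.le))).le

/-- Again `W = ua' - u'a` has an integrable derivative and `W(0) = 0`, but `u'` is not known to be
in `L²`, so `W` need not be integrable a priori. That its limit `l` is 0 is seen from `(ua)' = 2a'u
- W`, where `a'u` and `ua` are integrable. -/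
theorem schrodinger_injective {s : ℝ} (hs : s ≠ 0) {q : ℝ → ℂ} {b : BoundaryCondition} {z : ℂ}
    (hsurj : ∀ h : L2, ∃ χ P : L2, ∃ a a' a'' : ℝ → ℂ, IsACWithDeriv a a' ∧ IsACWithDeriv a' a'' ∧
      χ =ᵐ[halfLine] a ∧ P =ᵐ[halfLine] a' ∧ b.Holds (a 0) (a' 0) ∧
      ((h + z • χ : L2) =ᵐ[halfLine] fun x => (s : ℂ) * a'' x + q x * a x))
    {ψ : L2} (hψ : (ψ, z • ψ) ∈ schrodingerGraph s q b) : ψ = 0 := by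
  obtain ⟨u, v, w, hu, hv, e1, hbc, d1⟩ := hψ
  refine eq_zero_of_integral_mul fun h => ?_
  obtain ⟨χ, P, a, a', a'', ha, ha', e2, e3, hbc', d2⟩ := hsurj h
  have hs' : (s : ℂ) ≠ 0 := by exact_mod_cast hs
  have hW := ((hu.mul ha').sub (hv.mul ha)).congr
    (h := fun x => (s : ℂ)⁻¹ * (ψ x * h x)) (fun _ _ => rfl) (by
      filter_upwards [e1, e2, d1, d2, Lp.coeFn_smul z ψ, Lp.coeFn_add h (z • χ),
        Lp.coeFn_smul z χ] with x a1 a2 b1 b2 s1 s2 s3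
      have t1 : z * u x = s * w x + q x * u x := (congrArg (z * ·) a1.symm).trans (s1.symm.trans b1)
      have t2 : h x + z * a x = s * a'' x + q x * a x := by
        refine (congrArg (h x + z * ·) a2.symm).trans (Eq.trans ?_ (s2.symm.trans b2))
        rw [Pi.add_apply, s3]; rfl
      have a1 : ψ x = u x := a1
      rw [a1]
      have : u x * h x = s * ((v x * a' x + a'' x * u x) - (w x * a x + a' x * v x)) := by
        linear_combination u x * t2 - a x * t1
      rw [this]
      field_simp)
  have hWd : Integrable (fun x => (s : ℂ)⁻¹ * (ψ x * h x)) halfLine :=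
    (integrable_mul_L2 ψ h).const_mul _
  have hlim := hW.tendsto_atTop hWd
  have h0 : u 0 * a' 0 - v 0 * a 0 = 0 := by
    cases b
    · have h1 : u 0 = 0 := hbc
      have h2 : a 0 = 0 := hbc'
      rw [h1, h2]; ring
    · have h1 : v 0 = 0 := hbc
      have h2 : a' 0 = 0 := hbc'
      rw [h1, h2]; ring
  rw [h0, zero_add, integral_const_mul] at hlim
  set l : ℂ := (s : ℂ)⁻¹ * ∫ x, ψ x * h x ∂halfLine with hl
  suffices l = 0 from (mul_eq_zero.1 this).resolve_left (inv_ne_zero hs')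
  have hZ := hu.mul ha
  have hZi : Integrable (fun x => u x * a x) halfLine := by
    refine (integrable_mul_L2 ψ χ).congr ?_
    filter_upwards [e1, e2] with x a1 a2
    have a1 : ψ x = u x := a1
    rw [a1, a2]
  have hPi : Integrable (fun x => 2 * (a' x * u x)) halfLine := by
    refine ((integrable_mul_L2 P ψ).const_mul 2).congr ?_
    filter_upwards [e1, e3] with x a1 a3
    have a1 : ψ x = u x := a1
    rw [a1, a3]
  have hZs : Integrable (fun x => u (x + 1) * a (x + 1)) halfLine := by
    have h1 : IntegrableOn (fun x => u x * a x) (Ioi (0 + 1)) :=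
      IntegrableOn.mono_set hZi (Ioi_subset_Ioi (by norm_num))
    have := (measurePreserving_add_right volume (1 : ℝ)).integrableOn_comp_preimage
      (MeasurableEquiv.addRight (1 : ℝ)).measurableEmbedding (f := fun x => u x * a x)
      (s := Ioi (0 + 1))
    have h2 := this.2 h1
    rw [preimage_add_const_Ioi] at h2
    rwa [add_sub_cancel_right] at h2
  -- Integrate `(ua)' = 2a'u - W` over `[x, x + 1]`. The left side is an integrable function of `x`,
  -- so its limit `-l` must be 0.
  have hdiff : Tendsto (fun x => u (x + 1) * a (x + 1) - u x * a x) atTop (𝓝 (0 - l)) := by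
    have hprim := intervalIntegral_tendsto_integral_Ioi 0 (f := fun x => 2 * (a' x * u x))
      (μ := volume) hPi tendsto_id
    have hprim' := hprim.comp (tendsto_atTop_add_const_right atTop (1 : ℝ) tendsto_id)
    have h3 := (hprim'.sub hprim).sub (tendsto_integral_window hW.continuousOn hlim)
    rw [sub_self] at h3
    refine h3.congr' ?_
    filter_upwards [eventually_ge_atTop 0] with x hx
    have hx1 : 0 ≤ x + 1 := by linarith
    have hPi' : ∀ y, 0 ≤ y → IntervalIntegrable (fun x => 2 * (a' x * u x)) volume 0 y :=
      fun y hy => (intervalIntegrable_iff_integrableOn_Ioc_of_le hy).2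
        (IntegrableOn.mono_set hPi Ioc_subset_Ioi_self)
    have hWi : ∀ y, 0 ≤ y → IntervalIntegrable (fun x => u x * a' x - v x * a x) volume 0 y := by
      intro y hy
      refine ContinuousOn.intervalIntegrable (hW.continuousOn.mono ?_)
      rw [uIcc_of_le hy]; exact Icc_subset_Ici_self
    have hval : ∀ y, 0 ≤ y → u y * a y = u 0 * a 0 + ((∫ t in (0 : ℝ)..y, 2 * (a' t * u t)) -
        ∫ t in (0 : ℝ)..y, (u t * a' t - v t * a t)) := by
      intro y hy
      rw [← intervalIntegral.integral_sub (hPi' y hy) (hWi y hy), hZ.2 y hy]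
      congr 2
      ext t
      ring
    have hwin : ∫ t in x..x + 1, (u t * a' t - v t * a t) =
        (∫ t in (0 : ℝ)..x + 1, (u t * a' t - v t * a t)) -
          ∫ t in (0 : ℝ)..x, (u t * a' t - v t * a t) :=
      (intervalIntegral.integral_interval_sub_left (hWi _ hx1) (hWi _ hx)).symm
    rw [hwin, hval x hx, hval (x + 1) hx1]
    simp only [Function.comp_apply, id]
    ring
  have := IsACWithDeriv.eq_zero_of_integrable_of_tendsto (hZs.sub hZi) hdiff
  simpa using this

/-! ### Resolvents of the Dirac and Schrödinger operators -/

namespace SystemData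

variable {κ : ℝ} {V : ℝ → Matrix (Fin 2) (Fin 2) ℂ} {w : ℝ → ℝ} (D : SystemData κ V w) (m : ℝ)

/-- `SystemData.sol` as an operator on spinors. -/
def spinorSol (ε r : ℂ) : Spinor →L[ℂ] Spinor :=
  ((WithLp.prodContinuousLinearEquiv 2 ℂ L2 L2).symm : (L2 × L2) →L[ℂ] Spinor) ∘L
    D.sol m ε r ∘L (WithLp.prodContinuousLinearEquiv 2 ℂ L2 L2 : Spinor →L[ℂ] (L2 × L2))

theorem tendsto_spinorSol {l : Filter ℝ} {ε r : ℝ → ℂ} {r₀ : ℂ}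
    (hu : IsUnit (1 - D.green r₀ * D.pert m 0)) (hε : Tendsto ε l (𝓝 0))
    (hr : Tendsto r l (𝓝 r₀)) :
    Tendsto (fun c => D.spinorSol m (ε c) (r c)) l (𝓝 (D.spinorSol m 0 r₀)) := by
  have h1 := D.tendsto_sol hu hε hr
  have h2 : Continuous fun X : L2 × L2 →L[ℂ] L2 × L2 =>
      ((WithLp.prodContinuousLinearEquiv 2 ℂ L2 L2).symm : (L2 × L2) →L[ℂ] Spinor) ∘L
        X ∘L (WithLp.prodContinuousLinearEquiv 2 ℂ L2 L2 : Spinor →L[ℂ] (L2 × L2)) := by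
    fun_prop
  exact (h2.tendsto _).comp h1

/-- The second component of `SystemData.sol` at `ε = 0`. -/
def schrodingerSol (r : ℂ) : L2 →L[ℂ] L2 :=
  ContinuousLinearMap.snd ℂ L2 L2 ∘L D.sol m 0 r ∘L ContinuousLinearMap.inr ℂ L2 L2

/-- At `ε = 0` the source ignores the first component and the output has none. -/
theorem spinorSol_zero (r : ℂ) : D.spinorSol m 0 r = directSum 0 (D.schrodingerSol m r) := by
  ext1 y
  refine Spinor.ext ?_ ?_
  · change (D.out m 0 _).1 = 0
    simp [out, blockOp_apply]
  · change (D.sol m 0 r (y.fst, y.snd)).2 = (D.sol m 0 r (0, y.snd)).2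
    have : D.source m 0 (y.fst, y.snd) = D.source m 0 (0, y.snd) := by
      simp [source, blockOp_apply]
    simp only [sol, mul_apply_eq_comp, this]

variable {m}

theorem spinorSol_mem_diracGraph (hm : 0 < m) {c α : ℝ} (hc : 0 < c) {r : ℂ}
    (hu : IsUnit (1 - D.green r * D.pert m (c : ℂ)⁻¹))
    (hbc : (c : ℂ)⁻¹ * (κ / (2 * m)) * (1 - r) * Real.cos α = (1 + r) * Real.sin α) (y : Spinor) :
    (D.spinorSol m (c : ℂ)⁻¹ r y,
      y + (basePoint κ m - m * c ^ 2) • D.spinorSol m (c : ℂ)⁻¹ r y) ∈ diracGraph m c α V := by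
  obtain ⟨u, p, ξ, P, hau, hap, e1, e2, -, h0, h1⟩ := D.exists_solution m hu (y.fst, y.snd)
  have hc' : (c : ℂ) ≠ 0 := by exact_mod_cast hc.ne'
  have hm' : (m : ℂ) ≠ 0 := by exact_mod_cast hm.ne'
  have hκ' : (κ : ℂ) ≠ 0 := by exact_mod_cast (zero_lt_one.trans_le D.one_le).ne'
  refine ⟨_, _, _, _, hap.const_mul ((c : ℂ)⁻¹ * (κ / (2 * m))), hau, e1, e2, ?_, ?_, ?_⟩
  · rw [h0, h1]; linear_combination ξ * hbc
  · filter_upwards [e1, Lp.coeFn_add y.fst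
      ((basePoint κ m - m * c ^ 2) • (D.spinorSol m (c : ℂ)⁻¹ r y).fst),
      Lp.coeFn_smul (basePoint κ m - m * c ^ 2) (D.spinorSol m (c : ℂ)⁻¹ r y).fst]
      with x a1 a2 a3
    have a1 : (D.spinorSol m (c : ℂ)⁻¹ r y).fst x = _ := a1
    refine a2.trans ?_
    rw [Pi.add_apply, a3, Pi.smul_apply, a1, smul_eq_mul]
    field_simp
    ring
  · filter_upwards [e2, Lp.coeFn_add y.snd
      ((basePoint κ m - m * c ^ 2) • (D.spinorSol m (c : ℂ)⁻¹ r y).snd),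
      Lp.coeFn_smul (basePoint κ m - m * c ^ 2) (D.spinorSol m (c : ℂ)⁻¹ r y).snd]
      with x a1 a2 a3
    have a1 : (D.spinorSol m (c : ℂ)⁻¹ r y).snd x = u x := a1
    refine a2.trans ?_
    rw [Pi.add_apply, a3, Pi.smul_apply, a1, smul_eq_mul, basePoint]
    field_simp
    ring

/-- `D` supplies surjectivity; `D'` solves the transposed problem and thereby supplies injectivity.
-/
theorem isResolventAt_dirac (D' : SystemData κ (fun x => (V x).transpose) w) (hm : 0 < m)
    {c α : ℝ} (hc : 0 < c) {r : ℂ} (hu : IsUnit (1 - D.green r * D.pert m (c : ℂ)⁻¹))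
    (hu' : IsUnit (1 - D'.green r * D'.pert m (c : ℂ)⁻¹))
    (hbc : (c : ℂ)⁻¹ * (κ / (2 * m)) * (1 - r) * Real.cos α = (1 + r) * Real.sin α) :
    IsResolventAt (addConst (dirac m c α V) (m * c ^ 2)) (basePoint κ m)
      (D.spinorSol m (c : ℂ)⁻¹ r) := by
  refine IsResolventAt.of_graph (fun x hx => ?_) fun y => ?_
  · rw [mem_graph_addConst, dirac_graph, ← sub_smul] at hx
    exact dirac_injective hc.ne' (fun h => ⟨_, D'.spinorSol_mem_diracGraph hm hc hu' hbc h⟩) hx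
  · rw [mem_graph_addConst, dirac_graph, add_sub_assoc, ← sub_smul]
    exact D.spinorSol_mem_diracGraph hm hc hu hbc y

/-- At `ε = 0` the first equation is `u' = κp` exactly. The scalar equation is its own transpose, so
`D` alone gives both surjectivity and injectivity. -/
theorem isResolventAt_schrodinger (hm : 0 < m) {r : ℂ} {b : BoundaryCondition}
    (hu : IsUnit (1 - D.green r * D.pert m 0))
    (hb : ∀ ξ : ℂ, b.Holds ((1 + r) * ξ) (κ * ((1 - r) * ξ))) :
    IsResolventAt (schrodinger (1 / (2 * m)) (fun x => V x 1 1) b) (basePoint κ m)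
      (D.schrodingerSol m r) := by
  have hm' : (m : ℂ) ≠ 0 := by exact_mod_cast hm.ne'
  have hκ' : (κ : ℂ) ≠ 0 := by exact_mod_cast (zero_lt_one.trans_le D.one_le).ne'
  have hsol : ∀ h : L2, ∃ P : L2, ∃ a a' a'' : ℝ → ℂ, IsACWithDeriv a a' ∧ IsACWithDeriv a' a'' ∧
      D.schrodingerSol m r h =ᵐ[halfLine] a ∧ P =ᵐ[halfLine] a' ∧ b.Holds (a 0) (a' 0) ∧
      ((h + basePoint κ m • D.schrodingerSol m r h : L2) =ᵐ[halfLine]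
        fun x => ((1 / (2 * m) : ℝ) : ℂ) * a'' x + V x 1 1 * a x) := by
    intro h
    obtain ⟨u, p, ξ, P, hau, hap, -, e2, e3, h0, h1⟩ := D.exists_solution m hu (0, h)
    have hau' : IsACWithDeriv u (fun x => κ * p x) :=
      hau.congr (fun _ _ => rfl) (Eventually.of_forall fun x => by simp)
    refine ⟨(κ : ℂ) • P, u, _, _, hau', hap.const_mul κ, e2, ?_, ?_, ?_⟩
    · filter_upwards [Lp.coeFn_smul (κ : ℂ) P, e3] with x a1 a2
      rw [a1, Pi.smul_apply, a2, smul_eq_mul]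
    · rw [h0, h1]; exact hb ξ
    · filter_upwards [e2, Lp.coeFn_add h (basePoint κ m • D.schrodingerSol m r h),
        Lp.coeFn_smul (basePoint κ m) (D.schrodingerSol m r h)] with x a1 a2 a3
      have a1 : D.schrodingerSol m r h x = u x := a1
      rw [a2, Pi.add_apply, a3, Pi.smul_apply, a1, smul_eq_mul, basePoint]
      push_cast
      field_simp
      ring
  refine IsResolventAt.of_graph (fun x hx => ?_) fun y => ?_
  · rw [schrodinger_graph] at hx
    refine schrodinger_injective (by positivity) (fun h => ?_) hx
    obtain ⟨P, hP⟩ := hsol h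
    exact ⟨_, P, hP⟩
  · rw [schrodinger_graph]
    obtain ⟨P, a, a', a'', h1, h2, h3, -, h4, h5⟩ := hsol y
    exact ⟨a, a', a'', h1, h2, h3, h4, h5⟩

end SystemData

/-- Convergence of the resolvents at some point of the resolvent set of the limit operator. -/
def ResolventTendstoAtPoint {E F : Type*} [NormedAddCommGroup E] [NormedSpace ℂ E]
    [NormedAddCommGroup F] [NormedSpace ℂ F] (T : ℝ → E →ₗ.[ℂ] E) (S : F →ₗ.[ℂ] F)
    (J : (F →L[ℂ] F) → (E →L[ℂ] E)) : Prop :=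
  ∃ (z : ℂ) (R : F →L[ℂ] F) (Q : ℝ → E →L[ℂ] E), IsResolventAt S z R ∧
    (∀ᶠ c in atTop, IsResolventAt (T c) z (Q c)) ∧ Tendsto Q atTop (𝓝 (J R))

/-! ### The first limit and its boundary conditions. -/

section FirstLimit

variable {m : ℝ} (hm : 0 < m) {V : ℝ → Matrix (Fin 2) (Fin 2) ℂ}
  (hV : ∀ i j, Integrable (fun x => V x i j) halfLine)

include hm hV

/-- The reflection coefficient `r` encodes the boundary condition. -/
theorem resolventTendstoAtPoint_of_reflection {α : ℝ} {b : BoundaryCondition} {r₀ : ℂ}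
    (hr₀ : ‖r₀‖ ≤ 1) (hb : ∀ κ ξ : ℂ, b.Holds ((1 + r₀) * ξ) (κ * ((1 - r₀) * ξ)))
    (hr : ∀ κ : ℝ, 0 < κ → ∃ r : ℝ → ℂ, Tendsto r atTop (𝓝 r₀) ∧ ∀ c : ℝ, 0 < c →
      (c : ℂ)⁻¹ * (κ / (2 * m)) * (1 - r c) * Real.cos α = (1 + r c) * Real.sin α) :
    ResolventTendstoAtPoint (fun c : ℝ => addConst (dirac m c α V) (m * c ^ 2))
      (schrodinger (1 / (2 * m)) (fun x => V x 1 1) b) (fun R => directSum 0 R) := by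
  obtain ⟨w, hw, hVw⟩ := exists_weight hV
  -- `κ` is fixed before `c`; it meets the strict smallness condition for `V` and its transpose at
  -- once, as they share the weight `w`.
  set κ : ℝ := max 1 (6 * m * (schurConst w).toReal + 1) with hκ
  have hκ1 : 1 ≤ κ := le_max_left _ _
  have hκ2 : 6 * m * (schurConst w).toReal < κ := (lt_add_one _).trans_le (le_max_right _ _)
  obtain ⟨D⟩ := nonempty_systemData hκ1 hw (fun i j => (hV i j).1) hVw
  obtain ⟨D'⟩ := nonempty_systemData (V := fun x => (V x).transpose) hκ1 hw
    (fun i j => (hV j i).1) (fun i j => hVw j i)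
  obtain ⟨r, hrt, hbc⟩ := hr κ (zero_lt_one.trans_le hκ1)
  have hε : Tendsto (fun c : ℝ => (c : ℂ)⁻¹) atTop (𝓝 0) := by
    have h := (Complex.continuous_ofReal.tendsto 0).comp tendsto_inv_atTop_zero
    rw [Complex.ofReal_zero] at h
    exact h.congr fun c => by simp
  have hu := D.isUnit_zero hm hr₀ hκ2
  have hu' := D'.isUnit_zero hm hr₀ hκ2
  refine ⟨SystemData.basePoint κ m, D.schrodingerSol m r₀,
    fun c => D.spinorSol m (c : ℂ)⁻¹ (r c), D.isResolventAt_schrodinger hm hu (hb κ), ?_, ?_⟩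
  · filter_upwards [D.eventually_isUnit hu hε hrt, D'.eventually_isUnit hu' hε hrt,
      eventually_gt_atTop 0] with c h1 h2 hc
    exact D.isResolventAt_dirac D' hm hc h1 h2 (hbc c hc)
  · simp only
    rw [← D.spinorSol_zero]
    exact D.tendsto_spinorSol m hu hε hrt

theorem resolventTendstoAtPoint_dirichlet {α : ℝ} (hα : α ∈ Ioc 0 (Real.pi / 2)) :
    ResolventTendstoAtPoint (fun c : ℝ => addConst (dirac m c α V) (m * c ^ 2))
      (schrodinger (1 / (2 * m)) (fun x => V x 1 1) .dirichlet) (fun R => directSum 0 R) := by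
  have hs : 0 < Real.sin α := Real.sin_pos_of_pos_of_lt_pi hα.1 (by linarith [hα.2, Real.pi_pos])
  have hco : 0 ≤ Real.cos α := Real.cos_nonneg_of_mem_Icc ⟨by linarith [hα.1, Real.pi_pos], hα.2⟩
  refine resolventTendstoAtPoint_of_reflection hm hV (r₀ := -1) (by simp)
    (fun κ ξ => by simp [BoundaryCondition.Holds]) fun κ hκ => ?_
  set t : ℝ → ℝ := fun c => c⁻¹ * (κ / (2 * m)) * Real.cos α with ht
  have htt : Tendsto t atTop (𝓝 0) := by
    have := (tendsto_inv_atTop_zero (𝕜 := ℝ)).mul_const (κ / (2 * m)) |>.mul_const (Real.cos α)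
    simpa using this
  -- The solution of `t(1 - r) = (1 + r) sin α`; as `t → 0` and `sin α > 0`, it tends to -1.
  refine ⟨fun c => (((t c - Real.sin α) / (t c + Real.sin α) : ℝ) : ℂ), ?_, fun c hc => ?_⟩
  · have h1 : Tendsto (fun c => (t c - Real.sin α) / (t c + Real.sin α)) atTop
        (𝓝 ((0 - Real.sin α) / (0 + Real.sin α))) :=
      (htt.sub_const _).div (htt.add_const _) (by simpa using hs.ne')
    have h2 : (0 - Real.sin α) / (0 + Real.sin α) = -1 := by
      field_simp
      ring
    rw [h2] at h1
    simpa [Function.comp_def] using (Complex.continuous_ofReal.tendsto (-1)).comp h1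
  · have hpos : t c + Real.sin α ≠ 0 := by
      have : 0 ≤ t c := by positivity
      linarith
    have key : t c * (1 - (t c - Real.sin α) / (t c + Real.sin α)) =
        (1 + (t c - Real.sin α) / (t c + Real.sin α)) * Real.sin α := by
      field_simp
      ring
    have key' := congrArg (fun x : ℝ => (x : ℂ)) key
    simp only [Complex.ofReal_mul, Complex.ofReal_add, Complex.ofReal_sub, Complex.ofReal_one] at key'
    rw [← key']
    simp only [ht]
    push_cast
    ring

/-- For `α = 0` the condition is `p(0) = 0` for every `c`, so `r = 1` throughout. -/
theorem resolventTendstoAtPoint_neumann :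
    ResolventTendstoAtPoint (fun c : ℝ => addConst (dirac m c 0 V) (m * c ^ 2))
      (schrodinger (1 / (2 * m)) (fun x => V x 1 1) .neumann) (fun R => directSum 0 R) :=
  resolventTendstoAtPoint_of_reflection hm hV (r₀ := 1) (by simp)
    (fun κ ξ => by simp [BoundaryCondition.Holds])
    fun κ _ => ⟨fun _ => 1, tendsto_const_nhds, fun c _ => by simp⟩

end FirstLimit

/-! ### Charge conjugation -/

/-- Here `T' = -σTσ` with an involution `σ`, hence `T' + z = -σ(T - z)σ`. -/
theorem IsResolventAt.conj_neg {E : Type*} [NormedAddCommGroup E] [NormedSpace ℂ E]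
    {T T' : E →ₗ.[ℂ] E} {σ : E →L[ℂ] E} (hσ : ∀ x, σ (σ x) = x)
    (hT : ∀ x y, (x, y) ∈ T'.graph ↔ (σ x, -σ y) ∈ T.graph) {z : ℂ} {R : E →L[ℂ] E}
    (h : IsResolventAt T z R) : IsResolventAt T' (-z) (-(σ ∘L R ∘L σ)) := by
  obtain ⟨hl, hr⟩ := isResolventAt_iff_graph.1 h
  refine isResolventAt_iff_graph.2 ⟨fun x y hxy => ?_, fun y => (hT _ _).2 ?_⟩
  · have h1 := hl _ _ ((hT x y).1 hxy)
    have e : -σ y - z • σ x = -σ (y - -z • x) := by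
      simp only [map_sub, map_smul, neg_smul, map_neg]; abel
    rw [e, map_neg] at h1
    change -σ (R (σ (y - -z • x))) = x
    rw [← map_neg, h1, hσ]
  · have h1 := T.graph.neg_mem (hr (σ y))
    change (σ (-σ (R (σ y))), -σ (y + -z • -σ (R (σ y)))) ∈ _
    have e : (σ (-σ (R (σ y))), -σ (y + -z • -σ (R (σ y)))) = -(R (σ y), σ y + z • R (σ y)) := by
      refine Prod.ext ?_ ?_
      · simp [hσ]
      · simp only [map_add, map_smul, hσ, Prod.snd_neg, smul_neg, neg_smul, neg_neg]
    rw [e]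
    exact h1

/-- The swap of the two components of a spinor. -/
def spinorSwap : Spinor →L[ℂ] Spinor :=
  ((WithLp.prodContinuousLinearEquiv 2 ℂ L2 L2).symm : (L2 × L2) →L[ℂ] Spinor) ∘L
    ((ContinuousLinearMap.snd ℂ L2 L2).prod (ContinuousLinearMap.fst ℂ L2 L2)) ∘L
      (WithLp.prodContinuousLinearEquiv 2 ℂ L2 L2 : Spinor →L[ℂ] (L2 × L2))

theorem spinorSwap_spinorSwap (x : Spinor) : spinorSwap (spinorSwap x) = x := rfl

/-- The potential after charge conjugation. -/
def conjPotential (V : ℝ → Matrix (Fin 2) (Fin 2) ℂ) (x : ℝ) : Matrix (Fin 2) (Fin 2) ℂ :=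
  Matrix.of fun i j => -V x i.rev j.rev

theorem conjPotential_conjPotential (V : ℝ → Matrix (Fin 2) (Fin 2) ℂ) :
    conjPotential (conjPotential V) = V := by
  ext x i j
  simp [conjPotential]

/-- Swapping components and negating leaves the differential expression `D₀` unchanged; only `V` and
the boundary angle transform. -/
theorem mem_diracGraph_conj {m c α : ℝ} {V : ℝ → Matrix (Fin 2) (Fin 2) ℂ} {x y : Spinor}
    (h : (x, y) ∈ diracGraph m c α V) :
    (spinorSwap x, -spinorSwap y) ∈ diracGraph m c (Real.pi / 2 - α) (conjPotential V) := by
  obtain ⟨u₁, u₂, g₁, g₂, hu₁, hu₂, e1, e2, hbc, d1, d2⟩ := h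
  refine ⟨u₂, u₁, g₂, g₁, hu₂, hu₁, e2, e1, ?_, ?_, ?_⟩
  · rw [Real.cos_pi_div_two_sub, Real.sin_pi_div_two_sub]
    linear_combination -hbc
  · filter_upwards [d2, Lp.coeFn_neg y.snd] with t a1 a2
    refine a2.trans ?_
    rw [Pi.neg_apply]
    refine (congrArg Neg.neg a1).trans ?_
    change _ = (m * c ^ 2 : ℂ) * u₂ t - c * g₁ t + (-V t 1 1 * u₂ t + -V t 1 0 * u₁ t)
    ring
  · filter_upwards [d1, Lp.coeFn_neg y.fst] with t a1 a2
    refine a2.trans ?_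
    rw [Pi.neg_apply]
    refine (congrArg Neg.neg a1).trans ?_
    change _ = c * g₂ t - (m * c ^ 2 : ℂ) * u₁ t + (-V t 0 1 * u₂ t + -V t 0 0 * u₁ t)
    ring

theorem mem_diracGraph_conj_iff {m c α : ℝ} {V : ℝ → Matrix (Fin 2) (Fin 2) ℂ} {x y : Spinor} :
    (x, y) ∈ diracGraph m c α V ↔
      (spinorSwap x, -spinorSwap y) ∈ diracGraph m c (Real.pi / 2 - α) (conjPotential V) := by
  refine ⟨mem_diracGraph_conj, fun h => ?_⟩
  have := mem_diracGraph_conj h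
  rw [conjPotential_conjPotential, sub_sub_cancel, map_neg, neg_neg] at this
  exact this

theorem mem_schrodingerGraph_neg {s : ℝ} {q : ℝ → ℂ} {b : BoundaryCondition} {x y : L2}
    (h : (x, y) ∈ schrodingerGraph s q b) :
    (x, -y) ∈ schrodingerGraph (-s) (fun t => -q t) b := by
  obtain ⟨u, v, w, hu, hv, e, hb, d⟩ := h
  refine ⟨u, v, w, hu, hv, e, hb, ?_⟩
  filter_upwards [d, Lp.coeFn_neg y] with t a1 a2
  refine a2.trans ?_
  rw [Pi.neg_apply]
  refine (congrArg Neg.neg a1).trans ?_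
  push_cast
  ring

/-- Conjugation reverses the sign of the shift `mc²`, turns `-V₁₁` in the lower corner into `V₁₁`,
and moves the limit to the other summand. -/
theorem ResolventTendstoAtPoint.conj {m α : ℝ} {V : ℝ → Matrix (Fin 2) (Fin 2) ℂ}
    {b : BoundaryCondition}
    (h : ResolventTendstoAtPoint
      (fun c : ℝ => addConst (dirac m c (Real.pi / 2 - α) (conjPotential V)) (m * c ^ 2))
      (schrodinger (1 / (2 * m)) (fun x => conjPotential V x 1 1) b) (fun R => directSum 0 R)) :
    ResolventTendstoAtPoint (fun c : ℝ => addConst (dirac m c α V) (-(m * c ^ 2)))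
      (schrodinger (-(1 / (2 * m))) (fun x => V x 0 0) b) (fun R => directSum R 0) := by
  obtain ⟨z, R, Q, hS, hT, hQ⟩ := h
  refine ⟨-z, -R, fun c => -(spinorSwap ∘L Q c ∘L spinorSwap), ?_, ?_, ?_⟩
  · refine hS.conj_neg (σ := ContinuousLinearMap.id ℂ L2) (fun _ => rfl) fun x y => ?_
    rw [schrodinger_graph, schrodinger_graph]
    constructor
    · intro h
      have := mem_schrodingerGraph_neg h
      rw [neg_neg] at this
      exact this
    · intro h
      have := mem_schrodingerGraph_neg h
      simp only [conjPotential, Matrix.of_apply, neg_neg] at this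
      simpa using this
  · filter_upwards [hT] with c hc
    refine hc.conj_neg spinorSwap_spinorSwap fun x y => ?_
    rw [mem_graph_addConst, mem_graph_addConst, dirac_graph, dirac_graph, mem_diracGraph_conj_iff]
    have e : -spinorSwap (y - -(m * c ^ 2 : ℂ) • x) =
        -spinorSwap y - (m * c ^ 2 : ℂ) • spinorSwap x := by
      simp only [map_sub, map_smul, neg_smul, map_neg]; abel
    rw [e]
  · have h2 : Continuous fun X : Spinor →L[ℂ] Spinor => -(spinorSwap ∘L X ∘L spinorSwap) := by
      fun_prop
    have h3 := (h2.tendsto _).comp hQ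
    have e : -(spinorSwap ∘L directSum 0 R ∘L spinorSwap) = directSum (-R) 0 := by
      ext1 x
      refine Spinor.ext rfl ?_
      change -(0 : L2) = 0
      simp
    rw [e] at h3
    exact h3

theorem integrable_conjPotential {V : ℝ → Matrix (Fin 2) (Fin 2) ℂ}
    (hV : ∀ i j, Integrable (fun x => V x i j) halfLine) (i j : Fin 2) :
    Integrable (fun x => conjPotential V x i j) halfLine :=
  (hV i.rev j.rev).neg

theorem ResolventTendstoAtPoint.first {T : ℝ → Spinor →ₗ.[ℂ] Spinor} {S : L2 →ₗ.[ℂ] L2}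
    (h : ResolventTendstoAtPoint T S (fun R => directSum 0 R)) :
    NormResolventTendsto T S (fun R => directSum 0 R) := by
  obtain ⟨z, R, Q, hS, hT, hQ⟩ := h
  refine normResolventTendsto_of_tendsto (fun A B => ?_) (fun a A => ?_) (fun A B => ?_) hS hT hQ
  · rw [← directSum_add, add_zero]
  · rw [← directSum_smul, smul_zero]
  · rw [← directSum_mul, mul_zero]

theorem ResolventTendstoAtPoint.second {T : ℝ → Spinor →ₗ.[ℂ] Spinor} {S : L2 →ₗ.[ℂ] L2}
    (h : ResolventTendstoAtPoint T S (fun R => directSum R 0)) :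
    NormResolventTendsto T S (fun R => directSum R 0) := by
  obtain ⟨z, R, Q, hS, hT, hQ⟩ := h
  refine normResolventTendsto_of_tendsto (fun A B => ?_) (fun a A => ?_) (fun A B => ?_) hS hT hQ
  · rw [← directSum_add, add_zero]
  · rw [← directSum_smul, smul_zero]
  · rw [← directSum_mul, mul_zero]

end HalfLineDirac

end

/-! ### The four cases. -/

theorem mainTheorem5 (m : ℝ) (hm : 0 < m) (V : ℝ → Matrix (Fin 2) (Fin 2) ℂ)
    (hV : ∀ i j, MeasureTheory.IntegrableOn (fun x => V x i j) (Set.Ioi 0)) :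
    (∀ α ∈ Set.Ioc 0 (Real.pi / 2),
      HalfLineDirac.NormResolventTendsto
        (fun c : ℝ => HalfLineDirac.addConst (HalfLineDirac.dirac m c α V) (m * c ^ 2))
        (HalfLineDirac.schrodinger (1 / (2 * m)) (fun x => V x 1 1) .dirichlet)
        (fun R => HalfLineDirac.directSum 0 R)) ∧
    HalfLineDirac.NormResolventTendsto
      (fun c : ℝ => HalfLineDirac.addConst (HalfLineDirac.dirac m c 0 V) (m * c ^ 2))
      (HalfLineDirac.schrodinger (1 / (2 * m)) (fun x => V x 1 1) .neumann)
      (fun R => HalfLineDirac.directSum 0 R) ∧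
    (∀ α ∈ Set.Ico 0 (Real.pi / 2),
      HalfLineDirac.NormResolventTendsto
        (fun c : ℝ => HalfLineDirac.addConst (HalfLineDirac.dirac m c α V) (-(m * c ^ 2)))
        (HalfLineDirac.schrodinger (-(1 / (2 * m))) (fun x => V x 0 0) .dirichlet)
        (fun R => HalfLineDirac.directSum R 0)) ∧
    HalfLineDirac.NormResolventTendsto
      (fun c : ℝ => HalfLineDirac.addConst (HalfLineDirac.dirac m c (Real.pi / 2) V) (-(m * c ^ 2)))
      (HalfLineDirac.schrodinger (-(1 / (2 * m))) (fun x => V x 0 0) .neumann)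
      (fun R => HalfLineDirac.directSum R 0) := by
  refine ⟨fun α hα => ?_, ?_, fun α hα => ?_, ?_⟩
  · exact (HalfLineDirac.resolventTendstoAtPoint_dirichlet hm hV hα).first
  · exact (HalfLineDirac.resolventTendstoAtPoint_neumann hm hV).first
  -- The conjugated angle `π/2 - α` lies in `(0, π/2]`.
  · refine (HalfLineDirac.resolventTendstoAtPoint_dirichlet hm
      (HalfLineDirac.integrable_conjPotential hV) ⟨?_, ?_⟩).conj.second
    · linarith [hα.2]
    · linarith [hα.1]
  · refine HalfLineDirac.ResolventTendstoAtPoint.second (.conj ?_)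
    rw [sub_self]
    exact HalfLineDirac.resolventTendstoAtPoint_neumann hm
      (HalfLineDirac.integrable_conjPotential hV)
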